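/- Let $r>0$ and let $f$ be a real-valued function on $(0,\infty)$ that is piecewise continuous (finitely many discontinuities in each compact subinterval of $(0,\infty)$, finite one-sided limits at every point) and of exponential order $r$, i.e. $|f(t)|<Me^{rt}$ for all $t>0$, with some $M>0$. For $m\in\mathbb N_0$ and $\operatorname{Re}s>r$ let $$\varphi_m(s)=\int_0^\infty e^{-st}\,\frac{t^m}{m!}\,f(t)\,dt$$ be the Laplace-type transform of $f$. Fix $n\in\mathbb N_0$ and suppose that $\varphi_n$ continues to a function, again written $\varphi_n$, that is holomorphic on $\mathbb C$ except at finitely many points $s_0,\dots,s_k$, and that for some $c>r$ and some radii $R_m\to\infty$ the maximum of $|\varphi_n(s)|$ over the arc $|s|=R_m$, $\operatorname{Re}s\le c$, tends to $0$ as $m\to\infty$. Put $$g(t)=\frac{n!}{t^n}\sum_{j=0}^k\operatorname{Res}_{s=s_j}e^{st}\varphi_n(s)\qquad(t>0).$$ Then: (a) $f(t)=g(t)$ for every $t>0$ at which $f$ is continuous, and $\tfrac12\big(f(t-)+f(t+)\big)=g(t)$ for every $t>0$. (b) $g$ is the inverse Laplace-type transform of the sequence $\{\varphi_m\}_{m\in\mathbb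 N_0}$: for every real $\sigma>2r$, writing $\Delta_m$ for the forward difference operator in $m$ and $L_{k,\sigma}^*(x)=(-1)^k\sqrt\sigma\,\sum_{j=0}^k(-1)^j\binom kj\frac{(\sigma x)^j}{j!}$, one has $$\sum_{k=0}^\infty\Big|\Delta_m^k\big(\sigma^m\varphi_m(\sigma)\big)_{m=0}\Big|^2<\infty,\qquad g(x)=\sum_{k=0}^\infty\Delta_m^k\big(\sigma^m\varphi_m(\sigma)\big)_{m=0}\,\sqrt\sigma\,L_{k,\sigma}^*(x),$$ where $g\in L^2\big((0,\infty),e^{-\sigma x}dx\big)$ and the series converges to $g$ in that space. -/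

import Mathlib

open Set Filter Topology MeasureTheory
open scoped Nat

noncomputable section

/-- `f` is piecewise continuous over `(0, ∞)`: finitely many discontinuities in every compact
subinterval, and finite one-sided limits at every point. -/
def PiecewiseContinuousOnPos (f : ℝ → ℝ) : Prop :=
  (∀ a b : ℝ, 0 < a → {t ∈ Icc a b | ¬ ContinuousAt f t}.Finite) ∧
  (∀ t : ℝ, 0 < t → ∃ l : ℝ, Tendsto f (𝓝[<] t) (𝓝 l)) ∧
  (∀ t : ℝ, 0 < t → ∃ u : ℝ, Tendsto f (𝓝[>] t) (𝓝 u))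

/-- `f` is of exponential order `r` on `(0, ∞)`. -/
def HasExponentialOrder (f : ℝ → ℝ) (r : ℝ) : Prop :=
  ∃ M : ℝ, 0 < M ∧ ∀ t : ℝ, 0 < t → |f t| < M * Real.exp (r * t)

/-- The Laplace-type transform
`φ_n(s) = ∫_0^∞ e^{-st} (t^n / n!) f(t) dt`, for complex `s`. -/
def laplaceType (f : ℝ → ℝ) (n : ℕ) (s : ℂ) : ℂ :=
  ∫ t in Ioi (0 : ℝ), Complex.exp (-s * t) * ((t : ℂ) ^ n / (n ! : ℂ)) * (f t : ℂ)

/-- The residue at `z` of a function that is holomorphic in a punctured neighbourhood of `z`: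
`(2πi)⁻¹ ∮ g` over the circle of radius `ε` about `z`, which does not depend on `ε` for small
`ε > 0`, whence the limit. -/
def residueAt (g : ℂ → ℂ) (z : ℂ) : ℂ :=
  limUnder (𝓝[>] (0 : ℝ)) fun ε : ℝ =>
    (2 * (Real.pi : ℂ) * Complex.I)⁻¹ * ∮ w in C(z, ε), g w

/-- The Laguerre polynomial `L_k(x) = ∑_{j=0}^k (-1)^j (k choose j) x^j / j!`. -/
def laguerreL (k : ℕ) (x : ℝ) : ℝ :=
  ∑ j ∈ Finset.range (k + 1), (-1 : ℝ) ^ j * (k.choose j : ℝ) * x ^ j / (j ! : ℝ)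

/-- The Laguerre functions `L*_{k,s}(x) = (-1)^k √s L_k(s x)`. -/
def laguerreStar (k : ℕ) (s x : ℝ) : ℝ :=
  (-1 : ℝ) ^ k * Real.sqrt s * laguerreL k (s * x)

/-- The measure `e^{-s x} dx` on `(0, ∞)`. -/
def expWeight (s : ℝ) : Measure ℝ :=
  (volume.restrict (Ioi (0 : ℝ))).withDensity fun x => ENNReal.ofReal (Real.exp (-s * x))

/-- The `k`-th forward difference in `n`, at `n = 0`, of the sequence `n ↦ s^n p_n(s)`. -/
def scaledDiff (p : ℕ → ℂ → ℂ) (s : ℝ) (k : ℕ) : ℂ :=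
  (fwdDiff (1 : ℕ))^[k] (fun n : ℕ => (s : ℂ) ^ n * p n (s : ℂ)) 0

/-- The sequence of functions `p` belongs to the space `S_c` (with parameter `s`):
`∑_k |Δ_n^k (s^n p_n(s))_{n=0}|² < ∞`. -/
def MemSc (p : ℕ → ℂ → ℂ) (s : ℝ) : Prop :=
  Summable fun k : ℕ => ‖scaledDiff p s k‖ ^ 2

/-- `g` is (a representative of) the inverse Laplace-type transform of the sequence `p ∈ S_c`:
`g = ∑_{k=0}^∞ Δ_n^k (s^n p_n(s))_{n=0} √s L*_{k,s}`,
the series converging to `g` in the Hilbert space `L²((0, ∞), e^{-s x} dx)`.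
This determines `g` up to equality almost everywhere on `(0, ∞)`. -/
structure IsInverseLaplaceType (p : ℕ → ℂ → ℂ) (s : ℝ) (g : ℝ → ℂ) : Prop where
  memSc : MemSc p s
  memLp : MemLp g 2 (expWeight s)
  tendsto : Tendsto
    (fun N : ℕ => eLpNorm
      (fun x : ℝ => g x - ∑ k ∈ Finset.range N,
        scaledDiff p s k * ((Real.sqrt s * laguerreStar k s x : ℝ) : ℂ)) 2 (expWeight s))
    atTop (𝓝 0)

/-- The function `t ↦ (n! / t^n) ∑_{z ∈ S} Res_{s = z} e^{st} Φ(s)`. -/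
def residueInversion (n : ℕ) (Φ : ℂ → ℂ) (S : Finset ℂ) (t : ℝ) : ℂ :=
  (n ! : ℂ) / (t : ℂ) ^ n * ∑ z ∈ S, residueAt (fun s => Complex.exp (s * t) * Φ s) z

end

/-! No Bromwich integral is needed. Write `Φ` as an entire function `E` plus principal parts `P z`,
each holomorphic off `z` and vanishing at infinity (`exists_principalParts`). As a Laplace transform
`Φ` is bounded on `c ≤ Re s`, and it is small on the arcs to the left; the maximum principle and
Liouville's theorem then force `E = 0` (`eq_sum_principalParts`).

The residue of `e^{st} Φ(s)` at `z` is `(2πi)⁻¹ ∮ e^{wt} P z w dw`. By Fubini and Cauchy's formula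
for the exterior of a circle, the Laplace transform of this function of `t` is `P z`
(`integral_exp_mul_circleIntegral`). Hence `t^n f(t) / n!` and the sum of residues have the same
Laplace transform on a vertical line, and Fourier uniqueness makes them equal almost everywhere.
Since the residue sum is continuous, the one-sided limits of `f` are its values, which is (a).

For (b), `σ > 2r` puts `f` in `L²(e^{-σx} dx)`, where the Laguerre functions form a Hilbert basis
(`laguerre_expansion`). The numbers `m! φ_m(σ)` are the moments of `f` for this weight, and their
scaled differences are, up to `√σ`, the Laguerre coefficients (`scaledDiff_laplaceType_mul_sqrt`).
The series is thus the orthonormal expansion of `f`, which equals `g` almost everywhere. -/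

/-! ### Uniqueness for Fourier transforms and for moments -/

theorem integral_withDensity_ofReal {ν : Measure ℝ} {h : ℝ → ℝ} (hh : AEMeasurable h ν)
    (F : ℝ → ℂ) :
    ∫ x, F x ∂(ν.withDensity fun x => ENNReal.ofReal (h x)) = ∫ x, max (h x) 0 • F x ∂ν := by
  rw [integral_withDensity_eq_integral_toReal_smul₀ hh.ennreal_ofReal (by simp)]
  simp [ENNReal.toReal_ofReal']

theorem integrable_max_smul {ν : Measure ℝ} {h : ℝ → ℝ} (hh : AEMeasurable h ν)
    {F : ℝ → ℂ} (hF : AEStronglyMeasurable F ν) (hi : Integrable (fun x => h x • F x) ν) :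
    Integrable (fun x => max (h x) 0 • F x) ν := by
  refine hi.mono ((hh.max aemeasurable_const).aestronglyMeasurable.smul hF) ?_
  filter_upwards with x
  rw [norm_smul, norm_smul]
  gcongr
  rw [Real.norm_eq_abs, Real.norm_eq_abs, abs_of_nonneg (le_max_right _ _)]
  exact max_le (le_abs_self _) (abs_nonneg _)

theorem integrable_withDensity_ofReal {ν : Measure ℝ} {h : ℝ → ℝ} (hh : AEMeasurable h ν)
    {F : ℝ → ℂ} (hF : AEStronglyMeasurable F ν) (hi : Integrable (fun x => h x • F x) ν) :
    Integrable F (ν.withDensity fun x => ENNReal.ofReal (h x)) := by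
  rw [integrable_withDensity_iff_integrable_smul₀' hh.ennreal_ofReal (by simp)]
  simpa [ENNReal.toReal_ofReal'] using integrable_max_smul hh hF hi

/-- `ENNReal.ofReal` truncates at zero, so the two measures carry the positive and the negative part
of `h`. This lets uniqueness theorems for positive measures be applied to a signed density. -/
theorem integral_withDensity_sub {ν : Measure ℝ} {h : ℝ → ℝ} (hh : AEMeasurable h ν)
    {F : ℝ → ℂ} (hF : AEStronglyMeasurable F ν) (hi : Integrable (fun x => h x • F x) ν) :
    ∫ x, F x ∂(ν.withDensity fun x => ENNReal.ofReal (h x)) -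
      ∫ x, F x ∂(ν.withDensity fun x => ENNReal.ofReal (-h x)) = ∫ x, h x • F x ∂ν := by
  have hn : Integrable (fun x => max (-h x) 0 • F x) ν :=
    integrable_max_smul hh.neg hF (by simpa using hi.neg)
  rw [integral_withDensity_ofReal hh, integral_withDensity_ofReal (h := fun x => -h x) hh.neg,
    ← integral_sub (integrable_max_smul hh hF hi) hn]
  congr 1 with x
  rw [← sub_smul]
  congr 1
  rcases le_total 0 (h x) with h0 | h0 <;> simp [h0]

/-- Equal measures have equal densities, so the positive and negative parts of `h` agree almost
everywhere; at each point one of them is zero, hence both are. -/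
theorem ae_eq_zero_of_withDensity_eq {ν : Measure ℝ} {h : ℝ → ℝ} (hh : Integrable h ν)
    (he : (ν.withDensity fun x => ENNReal.ofReal (h x)) =
      ν.withDensity fun x => ENNReal.ofReal (-h x)) : h =ᵐ[ν] 0 := by
  have hfin : ∫⁻ x, ENNReal.ofReal (h x) ∂ν ≠ ⊤ :=
    (hh.lintegral_lt_top).ne
  have := (withDensity_eq_iff hh.aemeasurable.ennreal_ofReal
    hh.neg.aemeasurable.ennreal_ofReal hfin).1 he
  filter_upwards [this] with x hx
  rcases le_total 0 (h x) with h0 | h0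
  · have : ENNReal.ofReal (h x) = 0 := by rw [hx]; simp [h0]
    exact le_antisymm (ENNReal.ofReal_eq_zero.1 this) h0
  · have : ENNReal.ofReal (-h x) = 0 := by
      have hx' : ENNReal.ofReal (h x) = ENNReal.ofReal (-h x) := hx
      rw [← hx']; simp [h0]
    have := ENNReal.ofReal_eq_zero.1 this
    simp only [Pi.zero_apply]; linarith

theorem isFiniteMeasure_withDensity_ofReal_of_integrable {ν : Measure ℝ} {h : ℝ → ℝ} (hh : Integrable h ν) :
    IsFiniteMeasure (ν.withDensity fun x => ENNReal.ofReal (h x)) :=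
  isFiniteMeasure_withDensity hh.lintegral_lt_top.ne

/-- An integrable real function with vanishing Fourier transform vanishes. -/
theorem ae_eq_zero_of_forall_integral_exp_eq_zero {ν : Measure ℝ} {h : ℝ → ℝ}
    (hh : Integrable h ν)
    (h0 : ∀ y : ℝ, ∫ x, h x • Complex.exp (y * x * Complex.I) ∂ν = 0) : h =ᵐ[ν] 0 := by
  refine ae_eq_zero_of_withDensity_eq hh ?_
  have := isFiniteMeasure_withDensity_ofReal_of_integrable hh
  have := isFiniteMeasure_withDensity_ofReal_of_integrable hh.neg
  simp only [Pi.neg_apply] at this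
  refine Measure.ext_of_charFun ?_
  ext y
  rw [charFun_apply_real, charFun_apply_real, ← sub_eq_zero,
    integral_withDensity_sub hh.aemeasurable (by fun_prop), h0 y]
  refine hh.norm.mono (hh.aestronglyMeasurable.smul (by fun_prop)) ?_
  filter_upwards with x
  rw [norm_smul, ← Complex.ofReal_mul, Complex.norm_exp_ofReal_mul_I]
  simp

/-- An integrable complex function with vanishing Fourier transform vanishes. -/
theorem ae_eq_zero_of_forall_integral_exp_eq_zero_complex {ν : Measure ℝ} {h : ℝ → ℂ}
    (hh : Integrable h ν)
    (h0 : ∀ y : ℝ, ∫ x, h x * Complex.exp (y * x * Complex.I) ∂ν = 0) : h =ᵐ[ν] 0 := by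
  have hint : ∀ y : ℝ, Integrable (fun x => h x * Complex.exp (y * x * Complex.I)) ν := by
    intro y
    refine hh.norm.mono (hh.aestronglyMeasurable.mul (by fun_prop)) ?_
    filter_upwards with x
    rw [norm_mul, ← Complex.ofReal_mul, Complex.norm_exp_ofReal_mul_I]
    simp
  -- Conjugating the hypothesis at `-y` shows that `star h` has vanishing transform too; so do the
  -- real and imaginary parts, to which the real case applies.
  have hconj : ∀ y x : ℝ, star (h x * Complex.exp ((-y : ℝ) * x * Complex.I)) =
      star (h x) * Complex.exp (y * x * Complex.I) := by
    intro y x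
    simp only [star_mul', Complex.star_def, ← Complex.exp_conj]
    simp
  have h1 : ∀ y : ℝ, ∫ x, star (h x) * Complex.exp (y * x * Complex.I) ∂ν = 0 := by
    intro y
    simp_rw [← hconj y]
    have := integral_conj (μ := ν) (f := fun x => h x * Complex.exp ((-y : ℝ) * x * Complex.I))
    rw [h0] at this
    simpa using this
  have hint1 : ∀ y : ℝ, Integrable (fun x => star (h x) * Complex.exp (y * x * Complex.I)) ν := by
    intro y
    simp_rw [← hconj y]
    exact Complex.conjLIE.integrable_comp_iff.2 (hint (-y))
  have hre : (fun x => (h x).re) =ᵐ[ν] 0 := by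
    refine ae_eq_zero_of_forall_integral_exp_eq_zero hh.re fun y => ?_
    have : ∀ x, (h x).re • Complex.exp (y * x * Complex.I) = (1 / 2 : ℂ) *
        (h x * Complex.exp (y * x * Complex.I) + star (h x) * Complex.exp (y * x * Complex.I)) := by
      intro x
      rw [← add_mul, Complex.star_def, Complex.add_conj, Complex.real_smul]
      push_cast; ring
    simp_rw [this]
    rw [integral_const_mul, integral_add (hint y) (hint1 y), h0, h1]
    simp
  have him : (fun x => (h x).im) =ᵐ[ν] 0 := by
    refine ae_eq_zero_of_forall_integral_exp_eq_zero hh.im fun y => ?_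
    have : ∀ x, (h x).im • Complex.exp (y * x * Complex.I) = (1 / (2 * Complex.I) : ℂ) *
        (h x * Complex.exp (y * x * Complex.I) - star (h x) * Complex.exp (y * x * Complex.I)) := by
      intro x
      rw [← sub_mul, Complex.star_def, Complex.sub_conj, Complex.real_smul]
      field_simp [Complex.I_ne_zero]
      push_cast; ring
    simp_rw [this]
    rw [integral_const_mul, integral_sub (hint y) (hint1 y), h0, h1]
    simp
  filter_upwards [hre, him] with x hx hy
  exact Complex.ext hx hy

open ProbabilityTheory in
/-- A function of exponential decay all of whose moments vanish is zero almost everywhere. -/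
theorem ae_eq_zero_of_forall_moment_eq_zero {ν : Measure ℝ} {h : ℝ → ℝ} {δ : ℝ} (hδ : 0 < δ)
    (hh : AEMeasurable h ν)
    (hexp : ∀ a : ℝ, |a| < δ → Integrable (fun x => h x * Real.exp (a * x)) ν)
    (h0 : ∀ k : ℕ, ∫ x, h x * x ^ k ∂ν = 0) : h =ᵐ[ν] 0 := by
  have hhi : Integrable h ν := by simpa using hexp 0 (by simpa using hδ)
  refine ae_eq_zero_of_withDensity_eq hhi ?_
  have := isFiniteMeasure_withDensity_ofReal_of_integrable hhi
  have := isFiniteMeasure_withDensity_ofReal_of_integrable hhi.neg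
  simp only [Pi.neg_apply] at this
  set μ := ν.withDensity fun x => ENNReal.ofReal (h x) with hμ
  set μ' := ν.withDensity fun x => ENNReal.ofReal (-h x) with hμ'
  -- Finite exponential moments make both complex moment generating functions analytic on the strip
  -- `|Re z| < δ`, which contains the imaginary axis.
  have hsub : Ioo (-δ) δ ⊆ integrableExpSet id μ := by
    intro a ha
    have := integrable_withDensity_ofReal hh (F := fun x => ((Real.exp (a * x) : ℝ) : ℂ))
      (by fun_prop) (by simpa using (hexp a (abs_lt.2 ha)).ofReal (𝕜 := ℂ))
    simpa [integrableExpSet, -Complex.ofReal_exp] using this.re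
  have hsub' : Ioo (-δ) δ ⊆ integrableExpSet id μ' := by
    intro a ha
    have := integrable_withDensity_ofReal (h := fun x => -h x) hh.neg
      (F := fun x => ((Real.exp (a * x) : ℝ) : ℂ))
      (by fun_prop) (by simpa using (hexp a (abs_lt.2 ha)).neg.ofReal (𝕜 := ℂ))
    simpa [integrableExpSet, -Complex.ofReal_exp] using this.re
  have hi := interior_maximal hsub isOpen_Ioo
  have hi' := interior_maximal hsub' isOpen_Ioo
  set U : Set ℂ := {z | z.re ∈ Ioo (-δ) δ}
  have hA : AnalyticOnNhd ℂ (complexMGF id μ) U := analyticOnNhd_complexMGF.mono fun z hz => hi hz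
  have hA' : AnalyticOnNhd ℂ (complexMGF id μ') U :=
    analyticOnNhd_complexMGF.mono fun z hz => hi' hz
  have h0U : (0 : ℂ) ∈ U := by simp [U, hδ]
  have hU : IsPreconnected U :=
    ((convex_Ioo (-δ) δ).linear_preimage Complex.reLm).isPreconnected
  have hmom : ∀ k : ℕ, Integrable (fun x => h x • ((x : ℂ) ^ k)) ν := by
    intro k
    have hm : Integrable (fun x => h x * Real.exp ((δ / 2) * x)) ν :=
      hexp _ (by rw [abs_of_pos (by positivity)]; linarith)
    have hm' : Integrable (fun x => h x * Real.exp ((-δ / 2) * x)) ν :=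
      hexp _ (by rw [abs_lt]; constructor <;> linarith)
    refine ((hm.norm.add hm'.norm).const_mul (k ! / (δ / 2) ^ k)).mono
      (hh.aestronglyMeasurable.smul (by fun_prop)) ?_
    filter_upwards with x
    have e1 : |x| ^ k ≤ k ! / (δ / 2) ^ k * Real.exp (δ / 2 * |x|) := by
      have := Real.pow_div_factorial_le_exp (δ / 2 * |x|) (by positivity) k
      rw [mul_pow] at this
      rw [div_mul_eq_mul_div, le_div_iff₀ (by positivity)]
      rw [div_le_iff₀ (by positivity)] at this
      linarith
    have e2 : Real.exp (δ / 2 * |x|) ≤ Real.exp (δ / 2 * x) + Real.exp (-δ / 2 * x) := by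
      rcases le_total 0 x with hx | hx
      · rw [abs_of_nonneg hx]; linarith [Real.exp_pos (-δ / 2 * x)]
      · rw [abs_of_nonpos hx, show δ / 2 * -x = -δ / 2 * x by ring]
        linarith [Real.exp_pos (δ / 2 * x)]
    have hk : (0 : ℝ) ≤ k ! / (δ / 2) ^ k := by positivity
    have e3 : |x| ^ k ≤ k ! / (δ / 2) ^ k * (Real.exp (δ / 2 * x) + Real.exp (-δ / 2 * x)) :=
      e1.trans (by gcongr)
    rw [norm_smul, norm_pow, Complex.norm_real, Real.norm_eq_abs, Real.norm_eq_abs,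
      Real.norm_eq_abs]
    refine le_trans (mul_le_mul_of_nonneg_left e3 (abs_nonneg _)) (le_of_eq ?_)
    simp only [Pi.add_apply, norm_mul, Real.norm_eq_abs, Real.abs_exp]
    rw [← mul_add, abs_mul, abs_of_nonneg hk, abs_of_nonneg (a := |h x| * _) (by positivity)]
    ring
  have hder : ∀ k : ℕ, iteratedDeriv k (complexMGF id μ) 0 = iteratedDeriv k (complexMGF id μ') 0 := by
    intro k
    rw [iteratedDeriv_complexMGF (hi h0U), iteratedDeriv_complexMGF (hi' h0U), ← sub_eq_zero]
    simp only [id, zero_mul, Complex.exp_zero, mul_one]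
    rw [hμ, hμ', integral_withDensity_sub hh (by fun_prop) (hmom k)]
    have := congrArg (fun r : ℝ => (r : ℂ)) (h0 k)
    simp only [← integral_complex_ofReal] at this
    simpa using this
  -- The derivatives at `0` are the moments, so the Taylor series agree. The identity theorem
  -- carries this to the imaginary axis, where the values are the characteristic functions.
  have hev : complexMGF id μ =ᶠ[𝓝 0] complexMGF id μ' := by
    have p := (hA 0 h0U).hasFPowerSeriesAt
    have p' := (hA' 0 h0U).hasFPowerSeriesAt
    simp_rw [hder] at p
    have := p.sub p'
    rw [sub_self] at this
    filter_upwards [this.eventually_eq_zero] with z hz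
    exact sub_eq_zero.1 hz
  have heq := hA.eqOn_of_preconnected_of_eventuallyEq hA' hU h0U hev
  refine Measure.ext_of_charFun ?_
  ext y
  rw [← complexMGF_id_mul_I, ← complexMGF_id_mul_I]
  exact heq (by simp [U, hδ])

/-! ### Principal parts and residues at isolated singularities -/

open Metric in
/-- The Cauchy integral formula for an annulus. -/
theorem circleIntegral_sub_circleIntegral_eq {F : ℂ → ℂ} {z s : ℂ} {a b : ℝ} (ha : 0 < a)
    (hF : ∀ w, a ≤ dist w z → dist w z ≤ b → DifferentiableAt ℂ F w)
    (has : a < dist s z) (hsb : dist s z < b) :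
    (∮ w in C(z, b), (w - s)⁻¹ * F w) - ∮ w in C(z, a), (w - s)⁻¹ * F w =
      2 * Real.pi * Complex.I * F s := by
  have hb : 0 < b := ha.trans (has.trans hsb)
  set A := closedBall z b \ ball z a with hA
  have hFA : ∀ w ∈ A, DifferentiableAt ℂ F w := fun w hw =>
    hF w (not_lt.1 hw.2) hw.1
  have hsA : A ∈ 𝓝 s := by
    have : ball z b ∩ (closedBall z a)ᶜ ∈ 𝓝 s :=
      (isOpen_ball.inter isClosed_closedBall.isOpen_compl).mem_nhds
        ⟨hsb, by simpa using has⟩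
    refine mem_of_superset this fun w hw => ⟨ball_subset_closedBall hw.1, fun h =>
      hw.2 (ball_subset_closedBall h)⟩
  have hsF := hFA s (mem_of_mem_nhds hsA)
  have hcF : ContinuousOn F A := fun w hw => (hFA w hw).continuousAt.continuousWithinAt
  -- The difference quotient is continuous at `s` and holomorphic elsewhere in the annulus, so it
  -- has the same integral over both circles.
  have key : (∮ w in C(z, b), dslope F s w) = ∮ w in C(z, a), dslope F s w := by
    refine Complex.circleIntegral_eq_of_differentiable_on_annulus_off_countable ha
      (has.trans hsb).le (countable_singleton s) ((continuousOn_dslope hsA).2 ⟨hcF, hsF⟩) ?_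
    rintro w ⟨⟨hw1, hw2⟩, hws⟩
    exact (differentiableAt_dslope_of_ne (by simpa using hws)).2
      (hFA w ⟨ball_subset_closedBall hw1, fun h => hw2 (ball_subset_closedBall h)⟩)
  have expand : ∀ ρ : ℝ, 0 ≤ ρ → a ≤ ρ → ρ ≤ b → dist s z ≠ ρ →
      (∮ w in C(z, ρ), dslope F s w) =
        (∮ w in C(z, ρ), (w - s)⁻¹ * F w) - (∮ w in C(z, ρ), (w - s)⁻¹) * F s := by
    intro ρ hρ haρ hρb hne
    have hns : ∀ w ∈ sphere z ρ, w - s ≠ 0 := by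
      intro w hw h
      rw [sub_eq_zero] at h
      exact hne (h ▸ hw)
    have hinv : ContinuousOn (fun w => (w - s)⁻¹) (sphere z ρ) :=
      (continuousOn_id.sub continuousOn_const).inv₀ hns
    have hsub : sphere z ρ ⊆ A := by
      intro w hw
      rw [mem_sphere] at hw
      exact ⟨by simpa [hw] using hρb, by simpa [hw] using haρ⟩
    have h1 : (∮ w in C(z, ρ), (w - s)⁻¹) * F s = ∮ w in C(z, ρ), (w - s)⁻¹ * F s := by
      simpa only [mul_comm] using
        (circleIntegral.integral_const_mul (F s) (fun w => (w - s)⁻¹) z ρ).symm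
    have h2 := circleIntegral.integral_sub
      (f := fun w => (w - s)⁻¹ * F w) (g := fun w => (w - s)⁻¹ * F s)
      ((hinv.mul (hcF.mono hsub)).circleIntegrable hρ)
      ((hinv.mul continuousOn_const).circleIntegrable hρ)
    rw [h1, ← h2]
    refine circleIntegral.integral_congr hρ fun w hw => ?_
    have : w ≠ s := sub_ne_zero.1 (hns w hw)
    simp [dslope_of_ne _ this, slope_def_field]
    ring
  rw [expand b hb.le (has.trans hsb).le le_rfl hsb.ne, expand a ha.le le_rfl
    (has.trans hsb).le has.ne'] at key
  have hb1 : (∮ w in C(z, b), (w - s)⁻¹) = 2 * Real.pi * Complex.I :=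
    circleIntegral.integral_sub_inv_of_mem_ball hsb
  have ha1 : (∮ w in C(z, a), (w - s)⁻¹) = 0 := by
    refine Complex.circleIntegral_eq_zero_of_differentiable_on_off_countable ha.le
      countable_empty (f := fun w => (w - s)⁻¹) ?_ ?_
    · refine (continuousOn_id.sub continuousOn_const).inv₀ fun w hw h => ?_
      have h : w = s := sub_eq_zero.1 h
      rw [h, mem_closedBall] at hw
      exact absurd hw (not_le.2 has)
    · intro w hw
      refine (differentiableAt_id.sub_const s).inv fun h => ?_
      have h : w = s := sub_eq_zero.1 h
      have := hw.1
      rw [h, mem_ball] at this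
      exact absurd this (not_lt.2 has.le)
  rw [hb1, ha1] at key
  linear_combination key

open Metric in
theorem circleIntegral_cauchy_kernel_norm_le {F : ℂ → ℂ} {z s : ℂ} {a K : ℝ} (ha : 0 < a)
    (hK : ∀ w ∈ sphere z a, ‖F w‖ ≤ K) (hs : a < dist s z) :
    ‖∮ w in C(z, a), (w - s)⁻¹ * F w‖ ≤ 2 * Real.pi * a * ((dist s z - a)⁻¹ * K) := by
  refine circleIntegral.norm_integral_le_of_norm_le_const ha.le fun w hw => ?_
  rw [norm_mul, norm_inv]
  have h1 : dist s z - a ≤ ‖w - s‖ := by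
    rw [← dist_eq_norm]
    have := dist_triangle s w z
    rw [mem_sphere.1 hw, dist_comm s w] at this
    linarith
  have h2 : 0 < dist s z - a := by linarith
  gcongr
  exact hK w hw

open Metric in
theorem differentiableAt_circleIntegral_cauchy_kernel {F : ℂ → ℂ} {z s : ℂ} {a : ℝ} (ha : 0 < a)
    (hF : ContinuousOn F (sphere z a)) (hs : a < dist s z) :
    DifferentiableAt ℂ (fun s => ∮ w in C(z, a), (w - s)⁻¹ * F w) s := by
  -- Half the gap: points within `d` of `s` stay at distance at least `d` from the circle, which
  -- bounds the differentiated kernel uniformly.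
  set d := (dist s z - a) / 2 with hd
  have hd0 : 0 < d := by rw [hd]; linarith
  have hFc : Continuous fun θ : ℝ => F (circleMap z a θ) :=
    hF.comp_continuous (continuous_circleMap z a) fun θ => circleMap_mem_sphere z ha.le θ
  have hdist : ∀ x ∈ ball s d, ∀ θ : ℝ, d ≤ ‖circleMap z a θ - x‖ := by
    intro x hx θ
    have h1 := dist_triangle s x (circleMap z a θ)
    have h2 := dist_triangle s (circleMap z a θ) z
    have h3 : dist (circleMap z a θ) z = a := circleMap_mem_sphere z ha.le θ
    rw [mem_ball, dist_comm] at hx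
    rw [← dist_eq_norm, dist_comm]
    linarith
  have hcont : ∀ x ∈ ball s d, Continuous fun θ : ℝ => (circleMap z a θ - x)⁻¹ := fun x hx =>
    ((continuous_circleMap z a).sub continuous_const).inv₀ fun θ h => by
      have := hdist x hx θ
      change circleMap z a θ - x = 0 at h
      rw [h, norm_zero] at this
      linarith
  have hdm : Continuous fun θ : ℝ => deriv (circleMap z a) θ := by
    simp only [deriv_circleMap]; fun_prop
  obtain ⟨K, hK⟩ : ∃ K, ∀ θ ∈ Icc 0 (2 * Real.pi),
      ‖deriv (circleMap z a) θ * F (circleMap z a θ)‖ ≤ K :=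
    isCompact_Icc.exists_bound_of_continuousOn (hdm.mul hFc).continuousOn
  have := intervalIntegral.hasDerivAt_integral_of_dominated_loc_of_deriv_le
    (μ := volume) (a := 0) (b := 2 * Real.pi) (𝕜 := ℂ)
    (F := fun (x : ℂ) (θ : ℝ) => deriv (circleMap z a) θ • ((circleMap z a θ - x)⁻¹ *
      F (circleMap z a θ)))
    (F' := fun (x : ℂ) (θ : ℝ) => ((circleMap z a θ - x)⁻¹) ^ 2 *
      (deriv (circleMap z a) θ * F (circleMap z a θ)))
    (x₀ := s) (s := ball s d) (bound := fun _ => (d⁻¹) ^ 2 * K) (ball_mem_nhds s hd0)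
    (by
      filter_upwards [ball_mem_nhds s hd0] with x hx
      exact (hdm.smul ((hcont x hx).mul hFc)).aestronglyMeasurable)
    ((hdm.smul ((hcont s (mem_ball_self hd0)).mul hFc)).intervalIntegrable _ _)
    (((hcont s (mem_ball_self hd0)).pow 2).mul (hdm.mul hFc)).aestronglyMeasurable
    (by
      filter_upwards with θ hθ x hx
      rw [uIoc_of_le (by positivity)] at hθ
      rw [norm_mul, norm_pow, norm_inv]
      have h1 := hdist x hx θ
      gcongr
      exact hK θ ⟨hθ.1.le, hθ.2⟩)
    (by simp)
    (by
      filter_upwards with θ hθ x hx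
      have h1 := hdist x hx θ
      have hne : circleMap z a θ - x ≠ 0 := fun h => by
        rw [h, norm_zero] at h1; linarith
      have h2 : HasDerivAt (fun x : ℂ => circleMap z a θ - x) (-1) x := by
        simpa using (hasDerivAt_id x).const_sub (circleMap z a θ)
      have h3 := ((h2.inv hne).mul_const (F (circleMap z a θ))).const_mul
        (deriv (circleMap z a) θ)
      simp only [smul_eq_mul]
      refine h3.congr_deriv ?_
      rw [neg_neg, inv_pow]
      ring)
  exact this.2.differentiableAt

open Metric in
/-- The principal part of a function at an isolated singularity. -/
theorem exists_principalPart {F : ℂ → ℂ} {z : ℂ} {b : ℝ} (hb : 0 < b)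
    (hF : ∀ w, w ≠ z → dist w z ≤ b → DifferentiableAt ℂ F w) :
    ∃ P A : ℂ → ℂ, DifferentiableOn ℂ P {z}ᶜ ∧ Tendsto P (cocompact ℂ) (𝓝 0) ∧
      DifferentiableOn ℂ A (ball z b) ∧ ∀ s ∈ ball z b, s ≠ z → F s = P s + A s := by
  set c := (2 * Real.pi * Complex.I : ℂ) with hc
  have hc0 : c ≠ 0 := Complex.two_pi_I_ne_zero
  set A : ℂ → ℂ := fun s => c⁻¹ * ∮ w in C(z, b), (w - s)⁻¹ * F w with hA
  set a := b / 2 with ha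
  have ha0 : 0 < a := by positivity
  have hab : a < b := by rw [ha]; linarith
  have hcs : ∀ ρ : ℝ, 0 < ρ → ρ ≤ b → ContinuousOn F (sphere z ρ) := by
    intro ρ hρ hρb w hw
    refine (hF w ?_ (by rw [mem_sphere.1 hw]; exact hρb)).continuousAt.continuousWithinAt
    rintro rfl
    rw [mem_sphere, dist_self] at hw
    exact hρ.ne hw
  set B : ℂ → ℂ := fun s => -(c⁻¹ * ∮ w in C(z, a), (w - s)⁻¹ * F w) with hB
  have hAd : DifferentiableOn ℂ A (ball z b) := by
    have key : ∀ R : NNReal, 0 < R → CircleIntegrable F z R →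
        DifferentiableOn ℂ (fun s => c⁻¹ * ∮ w in C(z, R), (w - s)⁻¹ * F w) (ball z R) := by
      intro R hR hFR
      have h := (hasFPowerSeriesOn_cauchy_integral hFR hR).differentiableOn
      rw [Metric.eball_coe] at h
      simpa only [smul_eq_mul] using h
    have := key b.toNNReal (by simpa using hb)
    rw [Real.coe_toNNReal b hb.le] at this
    exact this ((hcs b hb le_rfl).circleIntegrable hb.le)
  have hBd : ∀ s, a < dist s z → DifferentiableAt ℂ B s := fun s hs =>
    ((differentiableAt_circleIntegral_cauchy_kernel ha0 (hcs a ha0 hab.le) hs).const_mul _).neg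
  have hAB : ∀ s, a < dist s z → dist s z < b → F s = B s + A s := by
    intro s h1 h2
    have := circleIntegral_sub_circleIntegral_eq (F := F) ha0 (fun w hw hw' => hF w (by
      rintro rfl
      rw [dist_self] at hw
      linarith) hw') h1 h2
    rw [← hc] at this
    simp only [hA, hB]
    rw [neg_add_eq_sub, ← mul_sub, this, inv_mul_cancel_left₀ hc0]
  -- `A` is holomorphic inside the outer circle, `B` outside the inner one, and `F = B + A` in
  -- between. So `F - A` and `B` agree on the overlap and glue; the value of `P` at `z` is
  -- immaterial.
  set P : ℂ → ℂ := fun s => if dist s z < b then F s - A s else B s with hP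
  have hPB : ∀ s, a < dist s z → P s = B s := by
    intro s hs
    simp only [hP]
    split_ifs with h
    · rw [hAB s hs h]; ring
    · rfl
  refine ⟨P, A, ?_, ?_, hAd, ?_⟩
  · intro s hs
    have hs : s ≠ z := hs
    refine DifferentiableAt.differentiableWithinAt ?_
    rcases lt_or_ge (dist s z) b with h | h
    · have : P =ᶠ[𝓝 s] fun s => F s - A s := by
        filter_upwards [isOpen_ball.mem_nhds (mem_ball.2 h)] with x hx
        exact if_pos hx
      exact this.differentiableAt_iff.2 ((hF s hs h.le).sub
        (hAd.differentiableAt (isOpen_ball.mem_nhds h)))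
    · have : P =ᶠ[𝓝 s] B := by
        filter_upwards [isClosed_closedBall.isOpen_compl.mem_nhds
          (show s ∈ (closedBall z a)ᶜ by simp; linarith)] with x hx
        exact hPB x (by simpa using hx)
      exact this.differentiableAt_iff.2 (hBd s (by linarith))
  · obtain ⟨K, hK⟩ := (isCompact_sphere z a).exists_bound_of_continuousOn (hcs a ha0 hab.le)
    have hd : Tendsto (fun s => dist s z - a) (cocompact ℂ) atTop :=
      tendsto_atTop_add_const_right _ _ (tendsto_dist_right_cocompact_atTop z)
    have hlim : Tendsto (fun s => ‖c⁻¹‖ * (2 * Real.pi * a * ((dist s z - a)⁻¹ * K)))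
        (cocompact ℂ) (𝓝 0) := by
      have := (((tendsto_inv_atTop_zero.comp hd).mul_const K).const_mul
        (2 * Real.pi * a)).const_mul ‖c⁻¹‖
      simpa using this
    refine squeeze_zero_norm' ?_ hlim
    filter_upwards [hd.eventually_gt_atTop 0] with s hs
    rw [hPB s (by linarith)]
    simp only [hB]
    rw [norm_neg, norm_mul]
    gcongr
    exact circleIntegral_cauchy_kernel_norm_le ha0 hK (by linarith)
  · intro s hs _
    simp only [hP]
    rw [if_pos (mem_ball.1 hs)]
    ring

/-- A function holomorphic off a finite set is the sum of its principal parts and an entire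
function. -/
theorem exists_principalParts (S : Finset ℂ) : ∀ F : ℂ → ℂ, DifferentiableOn ℂ F (S : Set ℂ)ᶜ →
    ∃ (P : ℂ → ℂ → ℂ) (E : ℂ → ℂ), (∀ z ∈ S, DifferentiableOn ℂ (P z) {z}ᶜ) ∧
      (∀ z ∈ S, Tendsto (P z) (cocompact ℂ) (𝓝 0)) ∧ Differentiable ℂ E ∧
      ∀ s ∉ S, F s = E s + ∑ z ∈ S, P z s := by
  classical
  induction S using Finset.induction_on with
  | empty =>
    intro F hF
    exact ⟨fun _ _ => 0, F, by simp, by simp, by simpa [differentiableOn_univ] using hF, by simp⟩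
  | insert z S hz ih =>
    intro F hF
    have hopen : ∀ T : Finset ℂ, IsOpen (T : Set ℂ)ᶜ := fun T => T.finite_toSet.isClosed.isOpen_compl
    have hFat : ∀ w, w ≠ z → w ∉ S → DifferentiableAt ℂ F w := fun w h1 h2 =>
      hF.differentiableAt ((hopen (insert z S)).mem_nhds (by simp [h1, h2]))
    obtain ⟨b, hb, hbS⟩ : ∃ b > 0, Metric.closedBall z b ⊆ (S : Set ℂ)ᶜ :=
      Metric.nhds_basis_closedBall.mem_iff.1 ((hopen S).mem_nhds (by simpa using hz))
    obtain ⟨P, A, hPd, hP0, hAd, hPA⟩ := exists_principalPart (F := F) hb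
      (fun w hw hwb => hFat w hw (by simpa using hbS hwb))
    have hPat : ∀ w, w ≠ z → DifferentiableAt ℂ P w := fun w hw =>
      hPd.differentiableAt (isOpen_compl_singleton.mem_nhds hw)
    -- Subtracting the principal part leaves a removable singularity at `z`, filled by `A z`; the
    -- induction hypothesis then applies with one singularity fewer.
    set G : ℂ → ℂ := fun s => if s = z then A z else F s - P s with hG
    have hGd : DifferentiableOn ℂ G (S : Set ℂ)ᶜ := by
      intro s hs
      refine DifferentiableAt.differentiableWithinAt ?_
      by_cases hsz : s = z
      · have : G =ᶠ[𝓝 s] A := by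
          rw [hsz]
          filter_upwards [Metric.ball_mem_nhds z hb] with x hx
          by_cases hxz : x = z
          · simp [hG, hxz]
          · simp [hG, hxz, hPA x hx hxz]
        rw [this.differentiableAt_iff, hsz]
        exact hAd.differentiableAt (Metric.ball_mem_nhds z hb)
      · have : G =ᶠ[𝓝 s] fun s => F s - P s := by
          filter_upwards [isOpen_compl_singleton.mem_nhds hsz] with x hx
          exact if_neg hx
        exact this.differentiableAt_iff.2 ((hFat s hsz (by simpa using hs)).sub (hPat s hsz))
    obtain ⟨Q, E, hQ, hQ0, hE, hsum⟩ := ih G hGd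
    have hQz : ∀ y ∈ S, y ≠ z := fun y hy h => hz (h ▸ hy)
    refine ⟨Function.update Q z P, E, ?_, ?_, hE, ?_⟩
    · intro y hy
      rcases Finset.mem_insert.1 hy with rfl | hy
      · simpa using hPd
      · simpa [Function.update_of_ne (hQz y hy)] using hQ y hy
    · intro y hy
      rcases Finset.mem_insert.1 hy with rfl | hy
      · simpa using hP0
      · simpa [Function.update_of_ne (hQz y hy)] using hQ0 y hy
    · intro s hs
      rw [Finset.mem_insert, not_or] at hs
      have := hsum s hs.2
      simp only [hG, if_neg hs.1] at this
      rw [Finset.sum_insert hz, Function.update_self, Finset.sum_congr rfl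
        (fun y hy => by rw [Function.update_of_ne (hQz y hy)])]
      linear_combination this

theorem circleIntegral_eq_of_differentiableOn_compl_singleton {P : ℂ → ℂ} {z : ℂ}
    (hP : DifferentiableOn ℂ P {z}ᶜ) {a b : ℝ} (ha : 0 < a) (hb : 0 < b) :
    (∮ w in C(z, a), P w) = ∮ w in C(z, b), P w := by
  wlog hab : a ≤ b generalizing a b
  · exact (this hb ha (le_of_not_ge hab)).symm
  have hat : ∀ w, w ∉ Metric.ball z a → DifferentiableAt ℂ P w := fun w hw =>
    hP.differentiableAt (isOpen_compl_singleton.mem_nhds fun h => hw (by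
      rw [mem_singleton_iff.1 h]; exact Metric.mem_ball_self ha))
  exact (Complex.circleIntegral_eq_of_differentiable_on_annulus_off_countable ha hab
    countable_empty (fun w hw => (hat w hw.2).continuousAt.continuousWithinAt)
    fun w hw => hat w fun h => hw.1.2 (Metric.ball_subset_closedBall h)).symm

/-- On small circles `B` integrates to zero and the integral of `P` does not depend on the radius,
so the limit is of an eventually constant function. Since `P` is singular only at `z`, radius `1` is
allowed even if the unit circle surrounds other singularities of `F`. -/
theorem residueAt_eq_circleIntegral {F P B : ℂ → ℂ} {z : ℂ} (hP : DifferentiableOn ℂ P {z}ᶜ)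
    (hB : ∀ᶠ w in 𝓝 z, DifferentiableAt ℂ B w)
    (hF : ∀ᶠ w in 𝓝[≠] z, F w = P w + B w) :
    residueAt F z = (2 * (Real.pi : ℂ) * Complex.I)⁻¹ * ∮ w in C(z, 1), P w := by
  refine Tendsto.limUnder_eq (tendsto_const_nhds.congr' ?_)
  rw [eventually_nhdsWithin_iff] at hF
  obtain ⟨d, hd, hball⟩ := Metric.eventually_nhds_iff_ball.1 (hF.and hB)
  filter_upwards [Ioo_mem_nhdsGT hd] with ε hε
  have hmem : ∀ w ∈ Metric.closedBall z ε, w ∈ Metric.ball z d := fun w hw =>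
    lt_of_le_of_lt hw hε.2
  have hsph : ∀ w ∈ Metric.sphere z ε, w ≠ z := by
    rintro w hw rfl
    rw [Metric.mem_sphere, dist_self] at hw
    exact hε.1.ne hw
  have hBc : ContinuousOn B (Metric.closedBall z ε) := fun w hw =>
    (hball w (hmem w hw)).2.continuousAt.continuousWithinAt
  congr 1
  rw [circleIntegral.integral_congr (g := fun w => P w + B w) hε.1.le fun w hw =>
      (hball w (hmem w (Metric.sphere_subset_closedBall hw))).1 (hsph w hw),
    circleIntegral.integral_add
      ((hP.continuousOn.mono hsph).circleIntegrable hε.1.le)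
      ((hBc.mono Metric.sphere_subset_closedBall).circleIntegrable hε.1.le),
    Complex.circleIntegral_eq_zero_of_differentiable_on_off_countable hε.1.le countable_empty hBc
      (fun w hw => (hball w (hmem w (Metric.ball_subset_closedBall hw.1))).2), add_zero]
  exact circleIntegral_eq_of_differentiableOn_compl_singleton hP one_pos hε.1

/-! ### Laplace transforms of residues -/

theorem integrableOn_pow_mul_exp_neg (k : ℕ) {b : ℝ} (hb : 0 < b) :
    IntegrableOn (fun t : ℝ => t ^ k * Real.exp (-b * t)) (Ioi 0) := by
  have := integrableOn_rpow_mul_exp_neg_mul_rpow (p := 1) (s := k) (b := b)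
    (by linarith [k.cast_nonneg (α := ℝ)]) one_pos hb
  simpa using this

theorem integral_pow_mul_exp_neg (k : ℕ) {b : ℝ} (hb : 0 < b) :
    ∫ t in Ioi (0 : ℝ), t ^ k * Real.exp (-b * t) = k ! / b ^ (k + 1) := by
  have := Real.integral_rpow_mul_exp_neg_mul_Ioi (a := k + 1) (by positivity) hb
  rw [Real.Gamma_nat_eq_factorial] at this
  simp only [add_sub_cancel_right, Real.rpow_natCast] at this
  simp only [neg_mul]
  rw [this]
  norm_cast
  rw [one_div, inv_pow]
  field_simp

/-- Cauchy's formula for the exterior: apply the annulus formula and let the outer radius grow;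
decay of `P` kills the outer integral, and the remaining sign is absorbed in `s - w`. -/
theorem circleIntegral_inv_sub_mul_eq {P : ℂ → ℂ} {z s : ℂ} (hP : DifferentiableOn ℂ P {z}ᶜ)
    (hP0 : Tendsto P (cocompact ℂ) (𝓝 0)) {a : ℝ} (ha : 0 < a) (hs : a < dist s z) :
    (2 * (Real.pi : ℂ) * Complex.I)⁻¹ * ∮ w in C(z, a), (s - w)⁻¹ * P w = P s := by
  have hat : ∀ w, w ≠ z → DifferentiableAt ℂ P w := fun w hw =>
    hP.differentiableAt (isOpen_compl_singleton.mem_nhds hw)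
  have hneg : (∮ w in C(z, a), (s - w)⁻¹ * P w) = -∮ w in C(z, a), (w - s)⁻¹ * P w := by
    rw [← neg_one_mul, ← circleIntegral.integral_const_mul]
    congr 1 with w
    rw [← neg_sub w s, inv_neg]; ring
  have hlim : Tendsto (fun b : ℝ => ∮ w in C(z, b), (w - s)⁻¹ * P w) atTop (𝓝 0) := by
    rw [Metric.tendsto_nhds]
    intro ε hε
    have hnorm : Tendsto (fun w => ‖P w‖) (cocompact ℂ) (𝓝 0) := by simpa using hP0.norm
    -- With `|w - s| ≥ b / 2` on the circle of radius `b`, this constant bounds the integral by `ε /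
    -- 2`.
    have hη : 0 < ε / (8 * Real.pi) := by positivity
    have hev := hnorm.eventually_lt_const hη
    rw [← Metric.cobounded_eq_cocompact, ← Metric.comap_dist_left_atTop z,
      eventually_comap] at hev
    filter_upwards [hev, eventually_gt_atTop (2 * dist s z), eventually_gt_atTop 0] with b hb h2 hb0
    rw [dist_zero_right]
    have hle : ‖∮ w in C(z, b), (w - s)⁻¹ * P w‖ ≤
        2 * Real.pi * b * ((b / 2)⁻¹ * (ε / (8 * Real.pi))) := by
      refine circleIntegral.norm_integral_le_of_norm_le_const hb0.le fun w hw => ?_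
      rw [norm_mul, norm_inv]
      have h1 : b / 2 ≤ ‖w - s‖ := by
        rw [← dist_eq_norm]
        have := dist_triangle w s z
        rw [Metric.mem_sphere.1 hw] at this
        linarith
      have h3 : ‖P w‖ ≤ ε / (8 * Real.pi) :=
        (hb w (by rw [dist_comm]; exact hw)).le
      gcongr
    refine hle.trans_lt ?_
    have : 2 * Real.pi * b * ((b / 2)⁻¹ * (ε / (8 * Real.pi))) = ε / 2 := by
      field_simp
      ring
    rw [this]
    linarith
  have hconst : Tendsto (fun b : ℝ => ∮ w in C(z, b), (w - s)⁻¹ * P w) atTop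
      (𝓝 ((∮ w in C(z, a), (w - s)⁻¹ * P w) + 2 * Real.pi * Complex.I * P s)) := by
    refine tendsto_const_nhds.congr' ?_
    filter_upwards [eventually_gt_atTop (dist s z)] with b hb
    rw [← circleIntegral_sub_circleIntegral_eq ha (fun w hw _ => hat w (by
      rintro rfl
      rw [dist_self] at hw
      linarith)) hs hb]
    ring
  have := tendsto_nhds_unique hlim hconst
  rw [hneg, inv_mul_eq_iff_eq_mul₀ Complex.two_pi_I_ne_zero]
  linear_combination this

theorem continuous_circleMap_comp {P : ℂ → ℂ} {z : ℂ} (hP : DifferentiableOn ℂ P {z}ᶜ) :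
    Continuous fun θ : ℝ => P (circleMap z 1 θ) :=
  hP.continuousOn.comp_continuous (continuous_circleMap z 1) fun _ =>
    circleMap_ne_center one_ne_zero

theorem continuous_circleIntegral_exp_mul {P : ℂ → ℂ} {z : ℂ} (hP : DifferentiableOn ℂ P {z}ᶜ) :
    Continuous fun t : ℝ => ∮ w in C(z, 1), Complex.exp (w * t) * P w := by
  refine intervalIntegral.continuous_parametric_intervalIntegral_of_continuous' ?_ _ _
  have h1 := (continuous_circleMap_comp hP).comp (continuous_snd (X := ℝ) (Y := ℝ))
  have h2 := (continuous_circleMap z 1).comp (continuous_snd (X := ℝ) (Y := ℝ))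
  simp only [deriv_circleMap, smul_eq_mul]
  refine Continuous.mul ?_ (Continuous.mul ?_ h1)
  · exact ((continuous_circleMap 0 1).comp continuous_snd).mul continuous_const
  · exact Complex.continuous_exp.comp (h2.mul (Complex.continuous_ofReal.comp continuous_fst))

theorem norm_circleIntegral_exp_mul_le {P : ℂ → ℂ} {z : ℂ} (hP : DifferentiableOn ℂ P {z}ᶜ) :
    ∃ K : ℝ, ∀ t : ℝ, 0 < t → ‖∮ w in C(z, 1), Complex.exp (w * t) * P w‖ ≤
      K * Real.exp ((‖z‖ + 1) * t) := by
  obtain ⟨K, hK⟩ := (isCompact_sphere z 1).exists_bound_of_continuousOn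
    (hP.continuousOn.mono fun w hw => Metric.ne_of_mem_sphere hw one_ne_zero)
  refine ⟨2 * Real.pi * K, fun t ht => ?_⟩
  have := circleIntegral.norm_integral_le_of_norm_le_const (R := 1) (c := z) zero_le_one
    (f := fun w => Complex.exp (w * t) * P w) (C := Real.exp ((‖z‖ + 1) * t) * K) fun w hw => by
      rw [norm_mul, Complex.norm_exp]
      have h1 : (w * (t : ℂ)).re ≤ (‖z‖ + 1) * t := by
        rw [Complex.re_mul_ofReal]
        gcongr
        have h2 := norm_le_norm_add_norm_sub' w z
        rw [← dist_eq_norm, Metric.mem_sphere.1 hw] at h2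
        exact (Complex.re_le_norm w).trans h2
      gcongr
      exact hK w hw
  refine this.trans (le_of_eq ?_)
  ring

theorem integrableOn_exp_mul_circleIntegral {P : ℂ → ℂ} {z s : ℂ}
    (hP : DifferentiableOn ℂ P {z}ᶜ) (hs : ‖z‖ + 1 < s.re) :
    IntegrableOn (fun t : ℝ => Complex.exp (-s * t) *
      ∮ w in C(z, 1), Complex.exp (w * t) * P w) (Ioi 0) := by
  obtain ⟨K, hK⟩ := norm_circleIntegral_exp_mul_le hP
  refine ((integrableOn_exp_mul_Ioi (a := ‖z‖ + 1 - s.re) (by linarith) 0).const_mul K).mono'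
    (Continuous.aestronglyMeasurable
      ((by fun_prop : Continuous fun t : ℝ => Complex.exp (-s * t)).mul
        (continuous_circleIntegral_exp_mul hP))) ?_
  filter_upwards [ae_restrict_mem measurableSet_Ioi] with t ht
  rw [norm_mul, Complex.norm_exp]
  calc _ ≤ Real.exp (-s * t).re * (K * Real.exp ((‖z‖ + 1) * t)) := by gcongr; exact hK t ht
    _ = _ := by
      rw [Complex.re_mul_ofReal, mul_left_comm, ← Real.exp_add, Complex.neg_re]
      ring_nf

/-- After Fubini the integral in `t` of `e^{-(s-w)t}` is `(s - w)⁻¹`, which leaves the exterior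
Cauchy formula. Convergence holds because `Re w ≤ ‖z‖ + 1` on the unit circle about `z`. -/
theorem integral_exp_mul_circleIntegral {P : ℂ → ℂ} {z s : ℂ}
    (hP : DifferentiableOn ℂ P {z}ᶜ) (hP0 : Tendsto P (cocompact ℂ) (𝓝 0))
    (hs : ‖z‖ + 1 < s.re) :
    ∫ t in Ioi (0 : ℝ), Complex.exp (-s * t) * ((2 * (Real.pi : ℂ) * Complex.I)⁻¹ *
      ∮ w in C(z, 1), Complex.exp (w * t) * P w) = P s := by
  have hPc := continuous_circleMap_comp hP
  have hre : ∀ θ : ℝ, (circleMap z 1 θ).re ≤ ‖z‖ + 1 := fun θ => by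
    have h2 := norm_le_norm_add_norm_sub' (circleMap z 1 θ) z
    rw [← dist_eq_norm, Metric.mem_sphere.1 (circleMap_mem_sphere z zero_le_one θ)] at h2
    exact (Complex.re_le_norm _).trans h2
  have hdist : 1 < dist s z := by
    have h1 := norm_le_norm_add_norm_sub' s z
    rw [← dist_eq_norm] at h1
    linarith [Complex.re_le_norm s]
  rw [← circleIntegral_inv_sub_mul_eq hP hP0 one_pos hdist]
  simp_rw [mul_left_comm (Complex.exp _)]
  rw [integral_const_mul]
  congr 1
  simp only [circleIntegral, smul_eq_mul, ← intervalIntegral.integral_const_mul]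
  have hF : Continuous (Function.uncurry fun (θ t : ℝ) => Complex.exp (-s * t) *
      (deriv (circleMap z 1) θ * (Complex.exp (circleMap z 1 θ * t) * P (circleMap z 1 θ)))) := by
    have h1 := hPc.comp (continuous_fst (X := ℝ) (Y := ℝ))
    have h2 := (continuous_circleMap z 1).comp (continuous_fst (X := ℝ) (Y := ℝ))
    have h3 : Continuous fun p : ℝ × ℝ => (p.2 : ℂ) := Complex.continuous_ofReal.comp continuous_snd
    simp only [deriv_circleMap]
    refine Continuous.mul ?_ (Continuous.mul ?_ (Continuous.mul ?_ h1))
    · exact Complex.continuous_exp.comp (continuous_const.mul h3)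
    · exact ((continuous_circleMap 0 1).comp continuous_fst).mul continuous_const
    · exact Complex.continuous_exp.comp (h2.mul h3)
  obtain ⟨K, hK⟩ := (isCompact_sphere z 1).exists_bound_of_continuousOn
    (hP.continuousOn.mono fun w hw => Metric.ne_of_mem_sphere hw one_ne_zero)
  rw [← intervalIntegral_integral_swap (f := fun (θ t : ℝ) => Complex.exp (-s * t) *
      (deriv (circleMap z 1) θ * (Complex.exp (circleMap z 1 θ * t) * P (circleMap z 1 θ))))]
  · congr 1 with θ
    have hneg : (circleMap z 1 θ - s).re < 0 := by
      rw [Complex.sub_re]; linarith [hre θ]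
    have := integral_exp_mul_complex_Ioi hneg 0
    simp only [Complex.ofReal_zero, mul_zero, Complex.exp_zero] at this
    calc _ = ∫ t in Ioi (0 : ℝ), (deriv (circleMap z 1) θ * P (circleMap z 1 θ)) *
          Complex.exp ((circleMap z 1 θ - s) * t) := by
          congr 1 with t
          rw [sub_mul, sub_eq_add_neg, Complex.exp_add, neg_mul]
          ring
      _ = _ := by
          rw [integral_const_mul, this, ← neg_sub s, div_neg, neg_div, neg_neg, one_div]
          ring
  · have hprod : Integrable (fun p : ℝ × ℝ => K * Real.exp ((‖z‖ + 1 - s.re) * p.2))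
        ((volume.restrict (uIoc 0 (2 * Real.pi))).prod (volume.restrict (Ioi 0))) := by
      have h1 : Integrable (fun _ : ℝ => K) (volume.restrict (uIoc 0 (2 * Real.pi))) :=
        integrableOn_const (by simp [ENNReal.mul_eq_top])
      exact h1.mul_prod (integrableOn_exp_mul_Ioi (a := ‖z‖ + 1 - s.re) (by linarith) 0)
    refine hprod.mono' hF.aestronglyMeasurable ?_
    rw [Measure.prod_restrict]
    filter_upwards [ae_restrict_mem (measurableSet_uIoc.prod measurableSet_Ioi)] with p hp
    obtain ⟨θ, t⟩ := p
    have ht : 0 < t := hp.2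
    simp only [Function.uncurry, norm_mul, Complex.norm_exp, deriv_circleMap, norm_circleMap_zero,
      Complex.norm_I, abs_one, one_mul, mul_one, Complex.re_mul_ofReal, Complex.neg_re]
    have h1 := hK _ (circleMap_mem_sphere z zero_le_one θ)
    calc _ ≤ Real.exp (-s.re * t) * (Real.exp ((‖z‖ + 1) * t) * K) := by
          gcongr
          exact hre θ
      _ = _ := by
          rw [← mul_assoc, ← Real.exp_add, mul_comm]
          ring_nf

/-! ### Vanishing of the entire part and inversion almost everywhere -/

/-- Exhausting `(0, ∞)` by the intervals `[1/(k+1), k+1]` shows the discontinuities to be countable,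
hence null; `f` is continuous on the measurable set that remains. -/
theorem PiecewiseContinuousOnPos.aestronglyMeasurable {f : ℝ → ℝ}
    (hf : PiecewiseContinuousOnPos f) : AEStronglyMeasurable f (volume.restrict (Ioi 0)) := by
  have hc : {t ∈ Ioi (0 : ℝ) | ¬ ContinuousAt f t}.Countable := by
    refine (countable_iUnion fun k : ℕ =>
      (hf.1 (1 / (k + 1 : ℝ)) (k + 1) (by positivity)).countable).mono ?_
    rintro t ⟨ht, htc⟩
    rw [mem_Ioi] at ht
    obtain ⟨k, hk⟩ := exists_nat_ge (max t t⁻¹)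
    refine mem_iUnion.2 ⟨k, ⟨?_, ?_⟩, htc⟩
    · rw [one_div]
      refine inv_le_of_inv_le₀ ht ?_
      linarith [le_max_right t t⁻¹]
    · linarith [le_max_left t t⁻¹]
  set A := {t ∈ Ioi (0 : ℝ) | ContinuousAt f t} with hA
  have hAm : MeasurableSet A := measurableSet_Ioi.inter (measurableSet_of_continuousAt f)
  have hcont : ContinuousOn f A := fun t ht => ht.2.continuousWithinAt
  have hae : A =ᵐ[volume] Ioi (0 : ℝ) := by
    refine (LE.le.eventuallyLE (show A ≤ Ioi 0 from fun t ht => ht.1)).antisymm ?_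
    have h0 := hc.ae_notMem volume
    filter_upwards [h0] with t ht htp
    by_contra h
    exact ht ⟨htp, fun hct => h ⟨htp, hct⟩⟩
  rw [← Measure.restrict_congr_set hae]
  exact hcont.aestronglyMeasurable hAm

theorem integrableOn_laplaceType {f : ℝ → ℝ} {r : ℝ}
    (hf : AEStronglyMeasurable f (volume.restrict (Ioi 0))) (hexp : HasExponentialOrder f r)
    (n : ℕ) {s : ℂ} (hs : r < s.re) :
    IntegrableOn (fun t : ℝ => Complex.exp (-s * t) * ((t : ℂ) ^ n / (n ! : ℂ)) * (f t : ℂ))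
      (Ioi 0) := by
  obtain ⟨M, hM, hfM⟩ := hexp
  refine ((integrableOn_pow_mul_exp_neg n (b := s.re - r) (by linarith)).const_mul
    (M / n !)).mono' ?_ ?_
  · refine AEStronglyMeasurable.mul (Continuous.aestronglyMeasurable (by fun_prop)) ?_
    exact Complex.continuous_ofReal.comp_aestronglyMeasurable hf
  · filter_upwards [ae_restrict_mem measurableSet_Ioi] with t ht
    have ht' : 0 < t := ht
    simp only [norm_mul, Complex.norm_exp, norm_div, norm_pow, Complex.norm_real,
      Complex.norm_natCast, Real.norm_eq_abs, Complex.re_mul_ofReal, Complex.neg_re,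
      abs_of_pos ht']
    calc _ ≤ Real.exp (-s.re * t) * (t ^ n / n !) * (M * Real.exp (r * t)) := by
          gcongr; exact (hfM t ht').le
      _ = M / n ! * (t ^ n * (Real.exp (-s.re * t) * Real.exp (r * t))) := by ring
      _ = _ := by rw [← Real.exp_add]; ring_nf

theorem norm_laplaceType_le {f : ℝ → ℝ} {r : ℝ} (hexp : HasExponentialOrder f r) (n : ℕ)
    {c : ℝ} (hc : r < c) : ∃ K : ℝ, ∀ s : ℂ, c ≤ s.re → ‖laplaceType f n s‖ ≤ K := by
  obtain ⟨M, hM, hfM⟩ := hexp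
  refine ⟨∫ t in Ioi (0 : ℝ), M / n ! * (t ^ n * Real.exp (-(c - r) * t)), fun s hs => ?_⟩
  refine norm_integral_le_of_norm_le
    ((integrableOn_pow_mul_exp_neg n (b := c - r) (by linarith)).const_mul (M / n !)) ?_
  filter_upwards [ae_restrict_mem measurableSet_Ioi] with t ht
  have ht' : 0 < t := ht
  simp only [norm_mul, Complex.norm_exp, norm_div, norm_pow, Complex.norm_real,
    Complex.norm_natCast, Real.norm_eq_abs, Complex.re_mul_ofReal, Complex.neg_re,
    abs_of_pos ht']
  calc _ ≤ Real.exp (-c * t) * (t ^ n / n !) * (M * Real.exp (r * t)) := by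
        gcongr; exact (hfM t ht').le
    _ = M / n ! * (t ^ n * (Real.exp (-c * t) * Real.exp (r * t))) := by ring
    _ = _ := by rw [← Real.exp_add]; ring_nf

/-- A function that is holomorphic off a finite set, bounded on a half-plane `c ≤ Re s` and small
on the arcs `‖s‖ = R m`, `Re s ≤ c` is the sum of its principal parts. -/
theorem eq_sum_principalParts {F : ℂ → ℂ} {S : Finset ℂ} {P : ℂ → ℂ → ℂ} {E : ℂ → ℂ}
    (hP0 : ∀ z ∈ S, Tendsto (P z) (cocompact ℂ) (𝓝 0)) (hE : Differentiable ℂ E)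
    (hsum : ∀ s ∉ S, F s = E s + ∑ z ∈ S, P z s) {c K : ℝ}
    (hK : ∀ s : ℂ, c ≤ s.re → ‖F s‖ ≤ K) {R : ℕ → ℝ} (hR : Tendsto R atTop atTop)
    (hdecay : ∀ ε : ℝ, 0 < ε → ∀ᶠ m in atTop, ∀ s : ℂ, ‖s‖ = R m → s.re ≤ c → ‖F s‖ ≤ ε)
    {s : ℂ} (hs : s ∉ S) : F s = ∑ z ∈ S, P z s := by
  have hPsum : Tendsto (fun s => ∑ z ∈ S, P z s) (cocompact ℂ) (𝓝 0) := by
    simpa using tendsto_finsetSum S hP0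
  have hsmall : ∀ ε > 0, ∀ᶠ m in atTop, ∀ s : ℂ, ‖s‖ = R m →
      s ∉ S ∧ ‖∑ z ∈ S, P z s‖ ≤ ε := by
    intro ε hε
    have h1 : ∀ᶠ s in cocompact ℂ, s ∉ S := S.finite_toSet.isCompact.compl_mem_cocompact
    have h2 : ∀ᶠ s in cocompact ℂ, ‖∑ z ∈ S, P z s‖ < ε :=
      (tendsto_zero_iff_norm_tendsto_zero.1 hPsum).eventually_lt_const hε
    have h3 := h1.and h2
    rw [← Metric.cobounded_eq_cocompact, ← comap_norm_atTop, eventually_comap] at h3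
    filter_upwards [hR.eventually h3] with m hm s hsm
    exact ⟨(hm s hsm).1, (hm s hsm).2.le⟩
  have hE' : ∀ s ∉ S, E s = F s - ∑ z ∈ S, P z s := fun s hs => by rw [hsum s hs]; ring
  -- Maximum principle on the disc of radius `R m`: on its boundary `F` is at most `K` to the right
  -- of `c` and at most `1` to the left, and the principal parts add at most `1`. The bound is
  -- independent of `m`.
  have hbound : ∀ s, ‖E s‖ ≤ max K 1 + 1 := by
    intro s
    obtain ⟨m, hm1, hm2, hm3, hm4⟩ := ((hsmall 1 one_pos).and ((hdecay 1 one_pos).and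
      ((hR.eventually_gt_atTop ‖s‖).and (hR.eventually_gt_atTop 0)))).exists
    refine Complex.norm_le_of_forall_mem_frontier_norm_le (U := Metric.ball 0 (R m))
      Metric.isBounded_ball hE.diffContOnCl ?_ (subset_closure (by simpa using hm3))
    intro w hw
    rw [frontier_ball _ hm4.ne', mem_sphere_zero_iff_norm] at hw
    obtain ⟨h1, h2⟩ := hm1 w hw
    rw [hE' w h1]
    refine (norm_sub_le _ _).trans (add_le_add ?_ h2)
    rcases le_total c w.re with h | h
    · exact (hK w h).trans (le_max_left _ _)
    · exact (hm2 w hw h).trans (le_max_right _ _)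
  have hrange : Bornology.IsBounded (range E) :=
    isBounded_iff_forall_norm_le.2 ⟨_, by rintro _ ⟨s, rfl⟩; exact hbound s⟩
  -- By Liouville `E` is constant, so it may be evaluated at `-R m`, which lies on the left arc once
  -- `R m ≥ -c`; there both `F` and the principal parts are small.
  have hzero : E s = 0 := by
    rw [← norm_le_zero_iff]
    refine le_of_forall_pos_le_add fun ε hε => ?_
    obtain ⟨m, hm1, hm2, hm3, hm4⟩ := ((hsmall (ε / 2) (by positivity)).and
      ((hdecay (ε / 2) (by positivity)).and
      ((hR.eventually_ge_atTop (-c)).and (hR.eventually_gt_atTop 0)))).exists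
    have hn : ‖(-(R m) : ℂ)‖ = R m := by simp [abs_of_pos hm4]
    rw [hE.apply_eq_apply_of_bounded hrange s (-(R m) : ℂ), hE' _ (hm1 _ hn).1]
    refine (norm_sub_le _ _).trans ?_
    have := hm2 _ hn (by simp; linarith)
    linarith [(hm1 _ hn).2]
  rw [hsum s hs, hzero, zero_add]

theorem ae_eq_sum_circleIntegral_of_laplaceType_eq {f : ℝ → ℝ} {r : ℝ}
    (hf : AEStronglyMeasurable f (volume.restrict (Ioi 0))) (hexp : HasExponentialOrder f r)
    {n : ℕ} {Φ : ℂ → ℂ} {S : Finset ℂ} {P : ℂ → ℂ → ℂ}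
    (hcont : ∀ s : ℂ, r < s.re → Φ s = laplaceType f n s)
    (hP : ∀ z ∈ S, DifferentiableOn ℂ (P z) {z}ᶜ)
    (hP0 : ∀ z ∈ S, Tendsto (P z) (cocompact ℂ) (𝓝 0))
    (hsum : ∀ s ∉ S, Φ s = ∑ z ∈ S, P z s) :
    ∀ᵐ t : ℝ ∂(volume.restrict (Ioi (0 : ℝ))), ((t : ℂ) ^ n / (n ! : ℂ)) * (f t : ℂ) =
      ∑ z ∈ S, (2 * (Real.pi : ℂ) * Complex.I)⁻¹ *
        ∮ w in C(z, 1), Complex.exp (w * t) * P z w := by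
  -- The abscissa exceeds `r` and every `‖z‖ + 1`, so all transforms converge on `Re s = a` and this
  -- line misses `S`.
  set a : ℝ := |r| + 1 + ∑ z ∈ S, (‖z‖ + 1) with ha
  have hsum0 : 0 ≤ ∑ z ∈ S, (‖z‖ + 1) := Finset.sum_nonneg fun z _ => by positivity
  have har : r < a := by linarith [le_abs_self r]
  have haz : ∀ z ∈ S, ‖z‖ + 1 < a := fun z hz => by
    have := Finset.single_le_sum (f := fun z : ℂ => ‖z‖ + 1) (fun z _ => by positivity) hz
    linarith [abs_nonneg r]
  set G : ℂ → ℝ → ℂ := fun z t => (2 * (Real.pi : ℂ) * Complex.I)⁻¹ *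
        ∮ w in C(z, 1), Complex.exp (w * t) * P z w with hG
  set W : ℝ → ℂ := fun t => ((t : ℂ) ^ n / (n ! : ℂ)) * (f t : ℂ) - ∑ z ∈ S, G z t with hW
  have hGi : ∀ s : ℂ, s.re = a → ∀ z ∈ S,
      IntegrableOn (fun t : ℝ => Complex.exp (-s * t) * G z t) (Ioi 0) := fun s hs z hz => by
    have := (integrableOn_exp_mul_circleIntegral (s := s) (hP z hz)
      (by rw [hs]; exact haz z hz)).const_mul (2 * (Real.pi : ℂ) * Complex.I)⁻¹
    refine this.congr (ae_of_all _ fun t => ?_)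
    simp only [hG]
    ring
  have hWexp : ∀ (s : ℂ) (t : ℝ), Complex.exp (-s * t) * W t =
      Complex.exp (-s * t) * ((t : ℂ) ^ n / (n ! : ℂ)) * (f t : ℂ) -
        ∑ z ∈ S, Complex.exp (-s * t) * G z t := fun s t => by
    simp only [hW]
    rw [mul_sub, Finset.mul_sum, mul_assoc]
  have hWi : ∀ s : ℂ, s.re = a →
      IntegrableOn (fun t : ℝ => Complex.exp (-s * t) * W t) (Ioi 0) := fun s hs => by
    simp_rw [hWexp]
    exact (integrableOn_laplaceType hf hexp n (by rw [hs]; exact har)).sub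
      (integrable_finsetSum S (hGi s hs))
  have hW0 : ∀ s : ℂ, s.re = a →
      ∫ t in Ioi (0 : ℝ), Complex.exp (-s * t) * W t = 0 := fun s hs => by
    simp_rw [hWexp]
    rw [integral_sub (integrableOn_laplaceType hf hexp n (by rw [hs]; exact har))
      (integrable_finsetSum S (hGi s hs)), integral_finsetSum S (hGi s hs),
      Finset.sum_congr rfl fun z hz =>
        integral_exp_mul_circleIntegral (hP z hz) (hP0 z hz) (by rw [hs]; exact haz z hz)]
    have hsS : s ∉ S := fun h => by
      have := haz s h
      linarith [Complex.re_le_norm s]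
    rw [← hsum s hsS, hcont s (by rw [hs]; exact har)]
    exact sub_self _
  -- With `s = a - iy`, the Laplace transform of `W` on the line is the Fourier transform of
  -- `e^{-at} W(t)`.
  have key := ae_eq_zero_of_forall_integral_exp_eq_zero_complex (hWi (a : ℂ) (by simp)) fun y => by
    rw [← hW0 ((a : ℂ) - y * Complex.I) (by simp)]
    congr 1 with t
    rw [mul_right_comm, ← Complex.exp_add]
    congr 2
    ring
  filter_upwards [key] with t ht
  have h := (mul_eq_zero.1 ht).resolve_left (Complex.exp_ne_zero _)
  exact sub_eq_zero.1 h

/-- Near `z` the entire part and the other principal parts are holomorphic, so they contribute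
nothing to the residue. -/
theorem residueAt_exp_mul_eq {Φ E : ℂ → ℂ} {S : Finset ℂ} {P : ℂ → ℂ → ℂ}
    (hP : ∀ z ∈ S, DifferentiableOn ℂ (P z) {z}ᶜ) (hE : Differentiable ℂ E)
    (hsum : ∀ s ∉ S, Φ s = E s + ∑ z ∈ S, P z s) (t : ℝ) {z : ℂ} (hz : z ∈ S) :
    residueAt (fun s => Complex.exp (s * t) * Φ s) z = (2 * (Real.pi : ℂ) * Complex.I)⁻¹ *
        ∮ w in C(z, 1), Complex.exp (w * t) * P z w := by
  classical
  have hopen : IsOpen ((S.erase z : Finset ℂ) : Set ℂ)ᶜ :=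
    (S.erase z).finite_toSet.isClosed.isOpen_compl
  have hmem : ∀ᶠ w in 𝓝 z, w ∉ S.erase z := hopen.mem_nhds (by simp)
  refine residueAt_eq_circleIntegral (P := fun w => Complex.exp (w * t) * P z w)
    (B := fun w => Complex.exp (w * t) * (E w + ∑ y ∈ S.erase z, P y w)) ?_ ?_ ?_
  · exact (by fun_prop : Differentiable ℂ fun w : ℂ => Complex.exp (w * t)).differentiableOn.mul
      (hP z hz)
  · filter_upwards [hmem] with w hw
    refine DifferentiableAt.mul (by fun_prop) (hE.differentiableAt.add ?_)
    refine DifferentiableAt.fun_sum fun y hy => ?_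
    refine (hP y (Finset.mem_of_mem_erase hy)).differentiableAt
      (isOpen_compl_singleton.mem_nhds fun h => hw ?_)
    rw [mem_singleton_iff.1 h]
    exact hy
  · filter_upwards [mem_nhdsWithin_of_mem_nhds hmem, self_mem_nhdsWithin] with w hw hwz
    rw [hsum w fun h => hw (Finset.mem_erase.2 ⟨hwz, h⟩), ← Finset.add_sum_erase S _ hz]
    ring

/-- Under the hypotheses of the inversion theorem, `residueInversion` is continuous on `(0, ∞)`
and agrees with `f` almost everywhere there. -/
theorem residueInversion_continuousOn_and_ae_eq {f : ℝ → ℝ} {r : ℝ}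
    (hf : PiecewiseContinuousOnPos f) (hexp : HasExponentialOrder f r) {n : ℕ} {Φ : ℂ → ℂ}
    {S : Finset ℂ} (hΦ : DifferentiableOn ℂ Φ ((S : Set ℂ)ᶜ))
    (hcont : ∀ s : ℂ, r < s.re → Φ s = laplaceType f n s)
    {c : ℝ} (hc : r < c) {R : ℕ → ℝ} (hR : Tendsto R atTop atTop)
    (hdecay : ∀ ε : ℝ, 0 < ε → ∀ᶠ m in atTop,
      ∀ s : ℂ, ‖s‖ = R m → s.re ≤ c → ‖Φ s‖ ≤ ε) :
    ContinuousOn (residueInversion n Φ S) (Ioi 0) ∧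
      ∀ᵐ t ∂(volume.restrict (Ioi (0 : ℝ))), (f t : ℂ) = residueInversion n Φ S t := by
  obtain ⟨P, E, hP, hP0, hE, hsum⟩ := exists_principalParts S Φ hΦ
  obtain ⟨K, hK⟩ := norm_laplaceType_le hexp n hc
  have hsum' : ∀ s ∉ S, Φ s = ∑ z ∈ S, P z s := fun s hs =>
    eq_sum_principalParts hP0 hE hsum (c := c) (K := K)
      (fun s hs => by rw [hcont s (hc.trans_le hs)]; exact hK s hs) hR hdecay hs
  have hrep : ∀ t : ℝ, residueInversion n Φ S t = (n ! : ℂ) / (t : ℂ) ^ n *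
      ∑ z ∈ S, (2 * (Real.pi : ℂ) * Complex.I)⁻¹ *
        ∮ w in C(z, 1), Complex.exp (w * t) * P z w := fun t => by
    rw [residueInversion, Finset.sum_congr rfl fun z hz => residueAt_exp_mul_eq hP hE hsum t hz]
  constructor
  · have hrep' := funext hrep
    rw [hrep']
    refine ContinuousOn.mul ?_ (Continuous.continuousOn ?_)
    · refine continuousOn_const.div (by fun_prop) fun t ht => ?_
      exact pow_ne_zero _ (Complex.ofReal_ne_zero.2 (ne_of_gt ht))
    · exact continuous_finsetSum _ fun z hz =>
        continuous_const.mul (continuous_circleIntegral_exp_mul (hP z hz))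
  · filter_upwards [ae_eq_sum_circleIntegral_of_laplaceType_eq hf.aestronglyMeasurable hexp hcont hP hP0
      hsum', ae_restrict_mem measurableSet_Ioi] with t ht ht0
    have h1 : (t : ℂ) ^ n ≠ 0 := pow_ne_zero _ (Complex.ofReal_ne_zero.2 (ne_of_gt ht0))
    have h2 : (n ! : ℂ) ≠ 0 := by exact_mod_cast n.factorial_ne_zero
    rw [hrep, ← ht]
    field_simp

/-! ### From almost everywhere equality to one-sided limits -/

/-- One-sided limits of a function that agrees almost everywhere with a continuous one. -/
theorem eq_of_tendsto_of_ae_eq {f : ℝ → ℝ} {g : ℝ → ℂ} {t : ℝ} {F : Filter ℝ} {l : ℝ}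
    (hF : (F ⊓ ae (volume : Measure ℝ)).NeBot) (hg : Tendsto g F (𝓝 (g t)))
    (hfg : ∀ᶠ x in F ⊓ ae (volume : Measure ℝ), (f x : ℂ) = g x) (hl : Tendsto f F (𝓝 l)) :
    (l : ℂ) = g t := by
  have h1 : Tendsto (fun x => (f x : ℂ)) (F ⊓ ae volume) (𝓝 (l : ℂ)) :=
    (Complex.continuous_ofReal.tendsto l).comp (hl.mono_left inf_le_left)
  exact tendsto_nhds_unique h1 ((hg.mono_left inf_le_left).congr' (by
    filter_upwards [hfg] with x hx using hx.symm))

/-- Intervals ending at `t` have positive measure, so a conull set meets each of them; a one-sided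
limit can therefore be taken along points where `f` and `g` agree. -/
theorem neBot_nhdsLT_inf_ae (t : ℝ) : (𝓝[<] t ⊓ ae (volume : Measure ℝ)).NeBot := by
  refine (frequently_true_iff_neBot _).1 (frequently_iff.2 fun {U} hU => ?_)
  obtain ⟨A, hA, B, hB, rfl⟩ := mem_inf_iff.1 hU
  obtain ⟨a, ha, haA⟩ := (mem_nhdsLT_iff_exists_Ioo_subset (a := t)).1 hA
  have hpos : volume (Ioo a t) ≠ 0 := by
    rw [Real.volume_Ioo]
    simpa using ha
  obtain ⟨x, hx, hxB⟩ : (Ioo a t ∩ B).Nonempty := by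
    by_contra h
    rw [not_nonempty_iff_eq_empty, ← disjoint_iff_inter_eq_empty] at h
    exact hpos (measure_mono_null h.subset_compl_right (mem_ae_iff.1 hB))
  exact ⟨x, ⟨haA hx, hxB⟩, trivial⟩

theorem neBot_nhdsGT_inf_ae (t : ℝ) : (𝓝[>] t ⊓ ae (volume : Measure ℝ)).NeBot := by
  refine (frequently_true_iff_neBot _).1 (frequently_iff.2 fun {U} hU => ?_)
  obtain ⟨A, hA, B, hB, rfl⟩ := mem_inf_iff.1 hU
  obtain ⟨a, ha, haA⟩ := (mem_nhdsGT_iff_exists_Ioo_subset (a := t)).1 hA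
  have hpos : volume (Ioo t a) ≠ 0 := by
    rw [Real.volume_Ioo]
    simpa using ha
  obtain ⟨x, hx, hxB⟩ : (Ioo t a ∩ B).Nonempty := by
    by_contra h
    rw [not_nonempty_iff_eq_empty, ← disjoint_iff_inter_eq_empty] at h
    exact hpos (measure_mono_null h.subset_compl_right (mem_ae_iff.1 hB))
  exact ⟨x, ⟨haA hx, hxB⟩, trivial⟩

theorem oneSided_limits_eq {f : ℝ → ℝ} {g : ℝ → ℂ} (hg : ContinuousOn g (Ioi 0))
    (hfg : ∀ᵐ t ∂(volume.restrict (Ioi (0 : ℝ))), (f t : ℂ) = g t) {t : ℝ} (ht : 0 < t) :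
    (∀ l : ℝ, Tendsto f (𝓝[<] t) (𝓝 l) → (l : ℂ) = g t) ∧
      ∀ u : ℝ, Tendsto f (𝓝[>] t) (𝓝 u) → (u : ℂ) = g t := by
  have hgt : Tendsto g (𝓝 t) (𝓝 (g t)) := hg.continuousAt (Ioi_mem_nhds ht)
  have hae := (ae_restrict_iff' measurableSet_Ioi).1 hfg
  have hev : ∀ F : Filter ℝ, F ≤ 𝓝 t → ∀ᶠ x in F ⊓ ae (volume : Measure ℝ), (f x : ℂ) = g x := by
    intro F hF
    filter_upwards [mem_inf_of_left (hF (Ioi_mem_nhds ht)), mem_inf_of_right hae] with x h1 h2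
    exact h2 h1
  exact ⟨fun l hl => eq_of_tendsto_of_ae_eq (neBot_nhdsLT_inf_ae t)
      (hgt.mono_left nhdsWithin_le_nhds) (hev _ nhdsWithin_le_nhds) hl,
    fun u hu => eq_of_tendsto_of_ae_eq (neBot_nhdsGT_inf_ae t)
      (hgt.mono_left nhdsWithin_le_nhds) (hev _ nhdsWithin_le_nhds) hu⟩

/-! ### Laguerre functions as a Hilbert basis -/

theorem integrable_expWeight_iff {s : ℝ} {h : ℝ → ℝ} : Integrable h (expWeight s) ↔
    IntegrableOn (fun x => Real.exp (-s * x) * h x) (Ioi 0) := by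
  rw [expWeight, integrable_withDensity_iff_integrable_smul' (by fun_prop) (by simp)]
  simp [ENNReal.toReal_ofReal, Real.exp_nonneg, IntegrableOn]

theorem integral_expWeight (s : ℝ) (h : ℝ → ℝ) : ∫ x, h x ∂(expWeight s) =
    ∫ x in Ioi (0 : ℝ), Real.exp (-s * x) * h x := by
  rw [expWeight, integral_withDensity_eq_integral_toReal_smul (by fun_prop) (by simp)]
  simp [ENNReal.toReal_ofReal, Real.exp_nonneg]

theorem expWeight_absolutelyContinuous (s : ℝ) :
    expWeight s ≪ volume.restrict (Ioi (0 : ℝ)) :=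
  withDensity_absolutelyContinuous _ _

theorem integrable_pow_expWeight {s : ℝ} (hs : 0 < s) (k : ℕ) :
    Integrable (fun x : ℝ => x ^ k) (expWeight s) := by
  rw [integrable_expWeight_iff]
  simpa only [mul_comm] using integrableOn_pow_mul_exp_neg k hs

theorem integral_pow_expWeight {s : ℝ} (hs : 0 < s) (k : ℕ) :
    ∫ x, x ^ k ∂(expWeight s) = k ! / s ^ (k + 1) := by
  rw [integral_expWeight, ← integral_pow_mul_exp_neg k hs]
  simp only [mul_comm]

/-- Squaring doubles the exponent; this is where the condition `σ > 2r` comes from. -/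
theorem memLp_two_exp_expWeight {s a : ℝ} (ha : a < s / 2) :
    MemLp (fun x : ℝ => Real.exp (a * x)) 2 (expWeight s) := by
  rw [memLp_two_iff_integrable_sq (by fun_prop), integrable_expWeight_iff]
  refine (integrableOn_exp_mul_Ioi (a := 2 * a - s) (by linarith) 0).congr
    (ae_of_all _ fun x => ?_)
  simp only
  rw [sq, ← Real.exp_add, ← Real.exp_add]
  ring_nf

theorem memLp_two_pow_expWeight {s : ℝ} (hs : 0 < s) (k : ℕ) :
    MemLp (fun x : ℝ => x ^ k) 2 (expWeight s) := by
  rw [memLp_two_iff_integrable_sq (by fun_prop)]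
  simp_rw [← pow_mul]
  exact integrable_pow_expWeight hs _

theorem HasExponentialOrder.memLp_two {f : ℝ → ℝ} {r s : ℝ}
    (hf : AEStronglyMeasurable f (volume.restrict (Ioi 0))) (hexp : HasExponentialOrder f r)
    (hs : 2 * r < s) : MemLp f 2 (expWeight s) := by
  obtain ⟨M, hM, hfM⟩ := hexp
  refine (((memLp_two_exp_expWeight (s := s) (a := r) (by linarith)).const_mul M)).mono
    (hf.mono_ac (expWeight_absolutelyContinuous s)) ?_
  refine (expWeight_absolutelyContinuous s).ae_le ?_
  filter_upwards [ae_restrict_mem measurableSet_Ioi] with t ht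
  rw [Real.norm_eq_abs, Real.norm_eq_abs, abs_of_nonneg (a := M * _) (by positivity)]
  exact (hfM t ht).le

/-- Up to the sign `(-1)^k` this is the `k`-th difference of `x ↦ x.choose i`, a polynomial of
degree `i`: after `i` differences it is the constant `1`, which any further difference kills. -/
theorem alternating_sum_choose_mul_choose {i k : ℕ} (hik : i ≤ k) :
    ∑ j ∈ Finset.range (k + 1), (-1 : ℤ) ^ j * k.choose j * ((j + i).choose i : ℤ) =
      if i = k then (-1) ^ k else 0 := by
  obtain ⟨d, rfl⟩ := Nat.exists_eq_add_of_le' hik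
  have h1 := fwdDiff_iter_eq_sum_shift (1 : ℕ) (fun x : ℕ => (x.choose i : ℤ)) (d + i) i
  have h2 : (fwdDiff (1 : ℕ))^[d + i] (fun x : ℕ => (x.choose i : ℤ)) i =
      if d = 0 then 1 else 0 := by
    have h3 := fwdDiff_iter_choose 0 i
    rw [add_zero] at h3
    rw [Function.iterate_add_apply, h3]
    rcases d with _ | d
    · simp
    · simp only [Nat.choose_zero_right, Nat.cast_one, Function.iterate_succ_apply, fwdDiff_const]
      rw [fwdDiff_iter_eq_sum_shift]
      simp
  rw [h2] at h1
  have h4 : ∑ j ∈ Finset.range (d + i + 1),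
      (-1 : ℤ) ^ j * (d + i).choose j * ((j + i).choose i : ℤ) =
      (-1) ^ (d + i) * ∑ j ∈ Finset.range (d + i + 1),
        ((-1 : ℤ) ^ (d + i - j) * (d + i).choose j) • ((i + j • 1).choose i : ℤ) := by
    rw [Finset.mul_sum]
    refine Finset.sum_congr rfl fun j hj => ?_
    have hj' : j ≤ d + i := Nat.lt_succ_iff.1 (Finset.mem_range.1 hj)
    obtain ⟨m, hm⟩ := Nat.exists_eq_add_of_le hj'
    have h5 : (-1 : ℤ) ^ m * (-1) ^ m = 1 := by rw [← mul_pow]; simp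
    rw [hm, Nat.add_sub_cancel_left, smul_eq_mul, smul_eq_mul, mul_one, add_comm i j, pow_add]
    linear_combination (-(-1 : ℤ) ^ j * (j + m).choose j * ((j + i).choose i : ℤ)) * h5
  rw [h4, ← h1]
  rcases d with _ | d
  · simp
  · simp

theorem integrable_mul_pow_expWeight {s : ℝ} (hs : 0 < s) {h : ℝ → ℝ}
    (hh : MemLp h 2 (expWeight s)) (k : ℕ) :
    Integrable (fun x => h x * x ^ k) (expWeight s) :=
  hh.integrable_mul (memLp_two_pow_expWeight hs k)

theorem integral_mul_laguerreL {s : ℝ} (hs : 0 < s) {h : ℝ → ℝ} (hh : MemLp h 2 (expWeight s))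
    (k : ℕ) : ∫ x, h x * laguerreL k (s * x) ∂(expWeight s) =
      ∑ j ∈ Finset.range (k + 1), (-1 : ℝ) ^ j * k.choose j * s ^ j / j ! *
        ∫ x, h x * x ^ j ∂(expWeight s) := by
  simp only [laguerreL, Finset.mul_sum]
  rw [integral_finsetSum]
  · refine Finset.sum_congr rfl fun j _ => ?_
    rw [← integral_const_mul]
    congr 1 with x
    rw [mul_pow]
    ring
  · intro j _
    refine ((integrable_mul_pow_expWeight hs hh j).const_mul
      ((-1 : ℝ) ^ j * k.choose j * s ^ j / j !)).congr (ae_of_all _ fun x => ?_)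
    simp only
    rw [mul_pow]
    ring

/-- The moments `(i + j)! / s^(i+j+1)` turn the integral into the alternating binomial sum; thus
`L_k` is orthogonal to all lower powers. -/
theorem integral_pow_mul_laguerreL {s : ℝ} (hs : 0 < s) {i k : ℕ} (hik : i ≤ k) :
    ∫ x, x ^ i * laguerreL k (s * x) ∂(expWeight s) =
      i ! / s ^ (i + 1) * if i = k then (-1) ^ k else 0 := by
  rw [integral_mul_laguerreL hs (memLp_two_pow_expWeight hs i)]
  have h1 := congrArg (fun m : ℤ => (m : ℝ)) (alternating_sum_choose_mul_choose hik)
  push_cast at h1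
  rw [← h1, Finset.mul_sum]
  refine Finset.sum_congr rfl fun j _ => ?_
  simp_rw [← pow_add]
  rw [integral_pow_expWeight hs, add_comm i j, ← Nat.add_choose_mul_factorial_mul_factorial j i,
    show j + i + 1 = j + (i + 1) by ring, pow_add s j]
  push_cast
  have h2 : (j ! : ℝ) ≠ 0 := by positivity
  field_simp

theorem memLp_two_laguerreL {s : ℝ} (hs : 0 < s) (k : ℕ) :
    MemLp (fun x => laguerreL k (s * x)) 2 (expWeight s) := by
  unfold laguerreL
  refine memLp_finsetSum _ fun j _ => ?_
  refine ((memLp_two_pow_expWeight hs j).const_mul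
    ((-1 : ℝ) ^ j * k.choose j * s ^ j / j !)).ae_eq (ae_of_all _ fun x => ?_)
  simp only
  rw [mul_pow]
  ring

theorem integral_laguerreL_mul_laguerreL {s : ℝ} (hs : 0 < s) (i k : ℕ) :
    ∫ x, laguerreL i (s * x) * laguerreL k (s * x) ∂(expWeight s) =
      if i = k then s⁻¹ else 0 := by
  wlog hik : i ≤ k generalizing i k
  · simp_rw [mul_comm (laguerreL i _), eq_comm (a := i)]
    exact this k i (le_of_not_ge hik)
  simp_rw [mul_comm (laguerreL i _)]
  -- The polynomial of lower index is expanded in powers; only its top power can pair nontrivially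
  -- with `L_k`, and only if `i = k`.
  rw [integral_mul_laguerreL hs (memLp_two_laguerreL hs k), Finset.sum_congr rfl fun j hj => by
    rw [funext fun x : ℝ => mul_comm (laguerreL k (s * x)) (x ^ j), integral_pow_mul_laguerreL hs
      ((Nat.lt_succ_iff.1 (Finset.mem_range.1 hj)).trans hik)]]
  rcases hik.eq_or_lt with rfl | hlt
  · rw [Finset.sum_eq_single_of_mem i (by simp)]
    · have h2 : (i ! : ℝ) ≠ 0 := by positivity
      have h5 : (-1 : ℝ) ^ i * (-1) ^ i = 1 := by rw [← mul_pow]; simp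
      simp only [Nat.choose_self, if_true]
      field_simp
      linear_combination (s * s ^ i) * h5
    · intro j _ hj
      simp [hj]
  · rw [if_neg hlt.ne]
    refine Finset.sum_eq_zero fun j hj => ?_
    have : j ≠ k := by
      have := Finset.mem_range.1 hj
      omega
    simp [this]

theorem memLp_two_laguerreStar {s : ℝ} (hs : 0 < s) (k : ℕ) :
    MemLp (laguerreStar k s) 2 (expWeight s) :=
  (memLp_two_laguerreL hs k).const_mul _

theorem integral_laguerreStar_mul_laguerreStar {s : ℝ} (hs : 0 < s) (i k : ℕ) :
    ∫ x, laguerreStar i s x * laguerreStar k s x ∂(expWeight s) = if i = k then 1 else 0 := by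
  have : ∀ x, laguerreStar i s x * laguerreStar k s x =
      ((-1 : ℝ) ^ i * (-1) ^ k * s) * (laguerreL i (s * x) * laguerreL k (s * x)) := by
    intro x
    have := Real.mul_self_sqrt hs.le
    simp only [laguerreStar]
    linear_combination ((-1 : ℝ) ^ i * (-1) ^ k * laguerreL i (s * x) * laguerreL k (s * x)) * this
  simp_rw [this]
  rw [integral_const_mul, integral_laguerreL_mul_laguerreL hs]
  split_ifs with h
  · subst h
    have h5 : (-1 : ℝ) ^ i * (-1) ^ i = 1 := by rw [← mul_pow]; simp
    rw [h5, one_mul, mul_inv_cancel₀ hs.ne']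
  · simp

/-- The Laguerre functions are complete. -/
theorem ae_eq_zero_of_forall_integral_mul_laguerreL_eq_zero {s : ℝ} (hs : 0 < s) {h : ℝ → ℝ}
    (hh : MemLp h 2 (expWeight s))
    (h0 : ∀ k, ∫ x, h x * laguerreL k (s * x) ∂(expWeight s) = 0) : h =ᵐ[expWeight s] 0 := by
  -- For `a < s / 2` both `h` and `e^{ax}` are square integrable, so their product is integrable.
  refine ae_eq_zero_of_forall_moment_eq_zero (δ := s / 2) (by positivity)
    hh.aestronglyMeasurable.aemeasurable
    (fun a ha => hh.integrable_mul (memLp_two_exp_expWeight (lt_of_abs_lt ha))) fun k => ?_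
  -- `L_k` has degree exactly `k`: once the lower moments vanish, orthogonality to it forces the
  -- `k`-th moment to vanish.
  induction k using Nat.strong_induction_on with
  | _ k ih =>
    have := h0 k
    rw [integral_mul_laguerreL hs hh, Finset.sum_range_succ, Finset.sum_eq_zero fun j hj => by
      rw [ih j (Finset.mem_range.1 hj), mul_zero], zero_add] at this
    refine (mul_eq_zero.1 this).resolve_left ?_
    rw [Nat.choose_self]
    have h2 : (k ! : ℝ) ≠ 0 := by positivity
    have h3 : s ^ k ≠ 0 := by positivity
    simp [h2, h3]

theorem inner_toLp_eq_integral {μ : Measure ℝ} {g : ℝ → ℝ} (hg : MemLp g 2 μ) (F : Lp ℝ 2 μ) :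
    inner ℝ (hg.toLp g) F = ∫ x, F x * g x ∂μ := by
  rw [L2.inner_def]
  refine integral_congr_ae ?_
  filter_upwards [hg.coeFn_toLp] with x hx
  rw [hx]
  simp

theorem orthonormal_laguerreStar {s : ℝ} (hs : 0 < s) :
    Orthonormal ℝ fun k => (memLp_two_laguerreStar hs k).toLp (laguerreStar k s) := by
  rw [orthonormal_iff_ite]
  intro i k
  rw [inner_toLp_eq_integral, ← integral_laguerreStar_mul_laguerreStar hs i k]
  refine integral_congr_ae ?_
  filter_upwards [(memLp_two_laguerreStar hs k).coeFn_toLp] with x hx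
  rw [hx, mul_comm]

theorem laguerreStar_span_orthogonal {s : ℝ} (hs : 0 < s) :
    (Submodule.span ℝ (range fun k =>
      (memLp_two_laguerreStar hs k).toLp (laguerreStar k s)))ᗮ = ⊥ := by
  refine (Submodule.eq_bot_iff _).2 fun F hF => ?_
  rw [Submodule.mem_orthogonal] at hF
  refine (Lp.eq_zero_iff_ae_eq_zero).2 ?_
  refine ae_eq_zero_of_forall_integral_mul_laguerreL_eq_zero hs (Lp.memLp F) fun k => ?_
  have h1 := hF _ (Submodule.subset_span (mem_range_self k))
  rw [inner_toLp_eq_integral] at h1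
  have h2 : ∀ x, F x * laguerreStar k s x =
      ((-1) ^ k * Real.sqrt s) * (F x * laguerreL k (s * x)) := fun x => by
    rw [laguerreStar]; ring
  simp_rw [h2] at h1
  rw [integral_const_mul] at h1
  exact (mul_eq_zero.1 h1).resolve_left
    (mul_ne_zero (pow_ne_zero _ (by norm_num)) (Real.sqrt_pos.2 hs).ne')

/-- The Laguerre expansion of a function in `L²((0, ∞), e^{-s x} dx)`. -/
theorem laguerre_expansion {s : ℝ} (hs : 0 < s) {h : ℝ → ℝ} (hh : MemLp h 2 (expWeight s)) :
    (Summable fun k => (∫ x, h x * laguerreStar k s x ∂(expWeight s)) ^ 2) ∧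
      Tendsto (fun N : ℕ => eLpNorm (fun x => h x - ∑ k ∈ Finset.range N,
        (∫ x, h x * laguerreStar k s x ∂(expWeight s)) * laguerreStar k s x) 2 (expWeight s))
        atTop (𝓝 0) := by
  set v := fun k => (memLp_two_laguerreStar hs k).toLp (laguerreStar k s) with hv
  have hon : Orthonormal ℝ v := orthonormal_laguerreStar hs
  have hcoef : ∀ k, inner ℝ (v k) (hh.toLp h) =
      ∫ x, h x * laguerreStar k s x ∂(expWeight s) := fun k => by
    rw [hv, inner_toLp_eq_integral]
    refine integral_congr_ae ?_
    filter_upwards [hh.coeFn_toLp] with x hx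
    rw [hx]
  constructor
  · have := hon.inner_products_summable (hh.toLp h)
    simpa only [hcoef, Real.norm_eq_abs, sq_abs] using this
  · set b := HilbertBasis.mkOfOrthogonalEqBot hon (laguerreStar_span_orthogonal hs) with hb
    have hbv : ∀ k, b k = v k := fun k => by rw [hb, HilbertBasis.coe_mkOfOrthogonalEqBot]
    have hsum := (b.hasSum_repr (hh.toLp h)).tendsto_sum_nat
    simp only [b.repr_apply_apply, hbv, hcoef] at hsum
    have hpart : ∀ N : ℕ, MemLp (fun x => ∑ k ∈ Finset.range N,
        (∫ x, h x * laguerreStar k s x ∂(expWeight s)) * laguerreStar k s x) 2 (expWeight s) :=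
      fun N => memLp_finsetSum _ fun k _ => (memLp_two_laguerreStar hs k).const_mul _
    have hto : ∀ N : ℕ, (hpart N).toLp _ = ∑ k ∈ Finset.range N,
        (∫ x, h x * laguerreStar k s x ∂(expWeight s)) • v k := fun N => by
      refine Lp.ext ?_
      refine (hpart N).coeFn_toLp.trans ?_
      have h1 := Lp.coeFn_finsetSum (Finset.range N)
        (fun k => (∫ x, h x * laguerreStar k s x ∂(expWeight s)) • v k)
      have h2 : ∀ᵐ x ∂(expWeight s), ∀ k, ((∫ x, h x * laguerreStar k s x ∂(expWeight s)) • v k) x =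
          (∫ x, h x * laguerreStar k s x ∂(expWeight s)) * laguerreStar k s x := by
        refine ae_all_iff.2 fun k => ?_
        filter_upwards [Lp.coeFn_smul (∫ x, h x * laguerreStar k s x ∂(expWeight s)) (v k),
          (memLp_two_laguerreStar hs k).coeFn_toLp] with x h3 h4
        rw [h3, Pi.smul_apply, hv, h4, smul_eq_mul]
      filter_upwards [h1, h2] with x h5 h6
      rw [h5]
      simp [h6]
    simp_rw [← hto] at hsum
    have := (Lp.tendsto_Lp_iff_tendsto_eLpNorm'' _ hpart h hh).1 hsum
    refine this.congr fun N => ?_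
    rw [← eLpNorm_neg]
    congr 1
    ext x
    simp

/-! ### Laguerre coefficients from the transforms, and the theorem -/

theorem laplaceType_ofReal (f : ℝ → ℝ) (m : ℕ) (s : ℝ) :
    laplaceType f m (s : ℂ) = ((∫ x, f x * x ^ m ∂(expWeight s)) / m ! : ℝ) := by
  rw [laplaceType, integral_expWeight, ← integral_div, ← integral_complex_ofReal]
  congr 1 with t
  push_cast
  ring

/-- The binomial expansion of the `k`-th difference at `0` has the coefficients of `L_k(s x)`,
applied to the moments of `f`; the sign `(-1)^k` in `laguerreStar` turns `(-1)^j` into `(-1)^(k-j)`.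
-/
theorem scaledDiff_laplaceType_mul_sqrt {f : ℝ → ℝ} {s : ℝ} (hs : 0 < s)
    (hf : MemLp f 2 (expWeight s)) (k : ℕ) :
    scaledDiff (laplaceType f) s k * (Real.sqrt s : ℂ) =
      ((∫ x, f x * laguerreStar k s x ∂(expWeight s) : ℝ) : ℂ) := by
  have h1 : ∀ x, f x * laguerreStar k s x =
      ((-1) ^ k * Real.sqrt s) * (f x * laguerreL k (s * x)) := fun x => by
    rw [laguerreStar]; ring
  simp_rw [h1]
  rw [integral_const_mul, integral_mul_laguerreL hs hf, scaledDiff, fwdDiff_iter_eq_sum_shift]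
  push_cast
  rw [Finset.sum_mul, Finset.mul_sum]
  refine Finset.sum_congr rfl fun j hj => ?_
  obtain ⟨m, rfl⟩ := Nat.exists_eq_add_of_le (Nat.lt_succ_iff.1 (Finset.mem_range.1 hj))
  have h5 : (-1 : ℂ) ^ j * (-1) ^ j = 1 := by rw [← mul_pow]; simp
  rw [zero_add, smul_eq_mul, mul_one, laplaceType_ofReal, Nat.add_sub_cancel_left, pow_add,
    zsmul_eq_mul]
  push_cast
  linear_combination (-((-1 : ℂ) ^ m * (j + m).choose j * s ^ j / j ! * Real.sqrt s *
    ((∫ x, f x * x ^ j ∂(expWeight s) : ℝ) : ℂ))) * h5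

theorem isInverseLaplaceType_of_ae_eq {f : ℝ → ℝ} {g : ℝ → ℂ} {s : ℝ} (hs : 0 < s)
    (hf : MemLp f 2 (expWeight s)) (hfg : (fun x => (f x : ℂ)) =ᵐ[expWeight s] g) :
    IsInverseLaplaceType (laplaceType f) s g := by
  obtain ⟨h1, h2⟩ := laguerre_expansion hs hf
  have hcoef := scaledDiff_laplaceType_mul_sqrt hs hf
  refine ⟨?_, ?_, ?_⟩
  · rw [MemSc]
    refine (h1.mul_left s⁻¹).congr fun k => ?_
    have := congrArg (fun z : ℂ => ‖z‖ ^ 2) (hcoef k)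
    simp only [norm_mul, Complex.norm_real, Real.norm_eq_abs, mul_pow, sq_abs,
      Real.sq_sqrt hs.le] at this
    rw [← this]
    field_simp
  · exact (MemLp.ofReal (K := ℂ) hf).ae_eq hfg
  · refine h2.congr fun N => ?_
    refine eLpNorm_congr_norm_ae ?_
    filter_upwards [hfg] with x hx
    rw [← hx, ← Complex.norm_real]
    congr 1
    push_cast
    congr 1
    refine Finset.sum_congr rfl fun k _ => ?_
    rw [← hcoef k]
    ring

theorem mainTheorem8
    (f : ℝ → ℝ) (r : ℝ) (hr : 0 < r)
    (hf : PiecewiseContinuousOnPos f) (hexp : HasExponentialOrder f r)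
    (n : ℕ)
    -- `Φ` continues `φ_n` analytically to the plane without the finitely many points of `S`
    (Φ : ℂ → ℂ) (S : Finset ℂ)
    (hΦ : DifferentiableOn ℂ Φ ((S : Set ℂ)ᶜ))
    (hcont : ∀ s : ℂ, r < s.re → Φ s = laplaceType f n s)
    -- `Φ` tends to zero along arcs `|s| = R m`, `Re s ≤ c`, whose radii tend to infinity
    (c : ℝ) (hc : r < c) (R : ℕ → ℝ) (hR : Tendsto R atTop atTop)
    (hdecay : ∀ ε : ℝ, 0 < ε → ∀ᶠ m in atTop,
      ∀ s : ℂ, ‖s‖ = R m → s.re ≤ c → ‖Φ s‖ ≤ ε) :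
    (∀ t : ℝ, 0 < t → ContinuousAt f t → (f t : ℂ) = residueInversion n Φ S t) ∧
    (∀ t : ℝ, 0 < t → ∀ l u : ℝ, Tendsto f (𝓝[<] t) (𝓝 l) → Tendsto f (𝓝[>] t) (𝓝 u) →
      (((l + u) / 2 : ℝ) : ℂ) = residueInversion n Φ S t) ∧
    (∀ σ : ℝ, 2 * r < σ →
      IsInverseLaplaceType (laplaceType f) σ (residueInversion n Φ S)) := by
  obtain ⟨hg, hfg⟩ := residueInversion_continuousOn_and_ae_eq hf hexp hΦ hcont hc hR hdecay
  refine ⟨fun t ht hft => ?_, fun t ht l u hl hu => ?_, fun σ hσ => ?_⟩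
  -- At a point of continuity `f t` is itself the left limit.
  · exact (oneSided_limits_eq hg hfg ht).1 _ (hft.mono_left nhdsWithin_le_nhds)
  · obtain ⟨h1, h2⟩ := oneSided_limits_eq hg hfg ht
    push_cast
    rw [h1 l hl, h2 u hu]
    ring
  · exact isInverseLaplaceType_of_ae_eq (by linarith)
      (hexp.memLp_two hf.aestronglyMeasurable hσ)
      ((expWeight_absolutelyContinuous σ).ae_le hfg)
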